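/- Let $A$ be a hereditary artin algebra, let $k$ be its center, and let $DA=\operatorname{Hom}_k(A,k)$, viewed as a left $A$-module by $(af)(x)=f(xa)$. For a left $A$-module $T$, let $B=\operatorname{End}_A(T)$ operate on the right of $T$, and let $\mathcal X(T)$ be the class of all left $B$-modules $N$ of finite length with $T\otimes_B N=0$. For $T=DA$, the canonical ring homomorphism $A\to B=\operatorname{End}_A(DA)$ sending $a$ to $f\mapsto fa$, where $(fa)(x)=f(ax)$, is an isomorphism, and we use it to regard $\mathcal X(DA)$ as a class of left $A$-modules. Let $\mathcal W(A)$ be the class of all left $A$-modules isomorphic to $\operatorname{Ext}^1_A(N,A_A)$ for some finitely generated right $A$-module $N$, where $A$ acts via left multiplication on $A_A$. Then: (1) $\mathcal W(A)=\mathcal X(DA)$. (2) $\mathcal X(DA)$ is the class of all left $A$-modules of finite length without an indecomposable projective direct summand. (3) $\mathcal W(A)$ is closed under submodules if and only if $A$ is a Nakayama algebra, that is, all finitely generated indecomposable projective left $A$-modules and all finitely generated indecomposable injective left $A$-modules are uniserial. -/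

import Mathlib

open CategoryTheory
open scoped TensorProduct

universe u

/-- A ring `A` is an artin algebra if its center is artinian and `A` is finitely generated as a
module over its center. -/
structure IsArtinAlgebra (A : Type u) [Ring A] : Prop where
  isArtinianRing_center : IsArtinianRing (Subring.center A)
  finite_center : Module.Finite (Subring.center A) A

/-- A ring is hereditary if all its left ideals and all its right ideals are projective. -/
structure IsHereditaryRing (A : Type u) [Ring A] : Prop where
  projective_left : ∀ I : Submodule A A, Module.Projective A I
  projective_right : ∀ I : Submodule Aᵐᵒᵖ A, Module.Projective Aᵐᵒᵖ I

/-- A module is indecomposable if it is nonzero and is not the direct sum of two nonzero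
submodules. -/
def IsIndecomposableModule (A : Type u) [Ring A] (M : Type u) [AddCommGroup M] [Module A M] :
    Prop :=
  Nontrivial M ∧ ∀ U V : Submodule A M, IsCompl U V → U = ⊥ ∨ V = ⊥

/-- A module is uniserial if its submodules form a chain. -/
def IsUniserialModule (A : Type u) [Ring A] (M : Type u) [AddCommGroup M] [Module A M] : Prop :=
  ∀ U V : Submodule A M, U ≤ V ∨ V ≤ U

/-- A Nakayama algebra is an artin algebra such that all (finitely generated) indecomposable
projective modules and all (finitely generated) indecomposable injective modules are uniserial. -/
structure IsNakayamaAlgebra (A : Type u) [Ring A] : Prop where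
  isArtinAlgebra : IsArtinAlgebra A
  uniserial_of_projective : ∀ (P : Type u) [AddCommGroup P] [Module A P], Module.Finite A P →
    Module.Projective A P → IsIndecomposableModule A P → IsUniserialModule A P
  uniserial_of_injective : ∀ (I : Type u) [AddCommGroup I] [Module A I], Module.Finite A I →
    Module.Injective A I → IsIndecomposableModule A I → IsUniserialModule A I

noncomputable section

/-! ### The left modules `Ext¹(N, A)` for right modules `N` -/

/-- Left multiplication by `a`, as an endomorphism of the right module `A`. -/
def rightRegularMul (A : Type u) [Ring A] (a : A) :
    ModuleCat.of Aᵐᵒᵖ A ⟶ ModuleCat.of Aᵐᵒᵖ A :=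
  ModuleCat.ofHom (Module.toModuleEnd Aᵐᵒᵖ A a)

/-- For a right `A`-module `N`, the group `Ext¹(N, A)` in the category of right `A`-modules. -/
def ExtOneRegular (A : Type u) [Ring A] (N : ModuleCat.{u} Aᵐᵒᵖ) : Type u :=
  Abelian.Ext N (ModuleCat.of Aᵐᵒᵖ A) 1

instance (A : Type u) [Ring A] (N : ModuleCat.{u} Aᵐᵒᵖ) : AddCommGroup (ExtOneRegular A N) :=
  inferInstanceAs (AddCommGroup (Abelian.Ext N (ModuleCat.of Aᵐᵒᵖ A) 1))

/-- The left `A`-module structure on `Ext¹(N, A)` given by the functoriality of `Ext¹(N, -)`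
applied to left multiplications. -/
instance (A : Type u) [Ring A] (N : ModuleCat.{u} Aᵐᵒᵖ) : Module A (ExtOneRegular A N) :=
  letI act (a : A) (e : Abelian.Ext N (ModuleCat.of Aᵐᵒᵖ A) 1) :
      Abelian.Ext N (ModuleCat.of Aᵐᵒᵖ A) 1 :=
    e.comp (Abelian.Ext.mk₀ (rightRegularMul A a)) (add_zero 1)
  { smul := act
    one_smul := fun (e : Abelian.Ext N (ModuleCat.of Aᵐᵒᵖ A) 1) => show act 1 e = e by
      have h : rightRegularMul A (1 : A) = 𝟙 _ := by
        simp only [rightRegularMul, map_one]; rfl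
      simp only [act, h, Abelian.Ext.comp_mk₀_id]
    mul_smul := fun a b (e : Abelian.Ext N (ModuleCat.of Aᵐᵒᵖ A) 1) =>
      show act (a * b) e = act a (act b e) by
        have h : rightRegularMul A (a * b) = rightRegularMul A b ≫ rightRegularMul A a := by
          simp only [rightRegularMul, map_mul]; rfl
        simp only [act, h, ← Abelian.Ext.mk₀_comp_mk₀]
        exact (Abelian.Ext.comp_assoc_of_third_deg_zero _ _ _ (add_zero 1)).symm
    smul_zero := fun a => show act a 0 = 0 by simp only [act, Abelian.Ext.zero_comp]
    smul_add := fun a (e f : Abelian.Ext N (ModuleCat.of Aᵐᵒᵖ A) 1) =>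
      show act a (e + f) = act a e + act a f from Abelian.Ext.add_comp _ _ _ _
    add_smul := fun a b (e : Abelian.Ext N (ModuleCat.of Aᵐᵒᵖ A) 1) =>
      show act (a + b) e = act a e + act b e by
        have h : rightRegularMul A (a + b) = rightRegularMul A a + rightRegularMul A b := by
          simp only [rightRegularMul, map_add]; rfl
        simp only [act, h, Abelian.Ext.mk₀_add, Abelian.Ext.comp_add]
    zero_smul := fun (e : Abelian.Ext N (ModuleCat.of Aᵐᵒᵖ A) 1) => show act 0 e = 0 by
      have h : rightRegularMul A (0 : A) = 0 := by
        simp only [rightRegularMul, map_zero]; rfl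
      simp only [act, h, Abelian.Ext.mk₀_zero, Abelian.Ext.comp_zero] }

/-- Auslander's class `𝒲(A)`: the left `A`-modules isomorphic to `Ext¹(N, A)` for some finitely
generated right `A`-module `N`. -/
def classW (A : Type u) [Ring A] : ObjectProperty (ModuleCat.{u} A) := fun M =>
  ∃ N : ModuleCat.{u} Aᵐᵒᵖ, Module.Finite Aᵐᵒᵖ N ∧ Nonempty (M ≃ₗ[A] ExtOneRegular A N)

/-! ### The class `𝒳(T)` -/

/-- For a left `A`-module `T`, the ring `B` of its endomorphisms operating on the right of `T`:
its multiplication is opposite to composition. -/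
abbrev RightEnd (A : Type u) [Ring A] (T : Type u) [AddCommGroup T] [Module A T] : Type u :=
  (Module.End A T)ᵐᵒᵖ

/-- The tensor product `T ⊗_B N` of the right `B`-module `T` with a left `B`-module `N`, where
`B = End_A(T)` operates on the right of `T`: the quotient of `T ⊗_ℤ N` by the relations
`t b ⊗ n = t ⊗ b n`. -/
abbrev TensorRightEnd (A : Type u) [Ring A] (T : Type u) [AddCommGroup T] [Module A T]
    (N : Type u) [AddCommGroup N] [Module (RightEnd A T) N] : Type u :=
  (T ⊗[ℤ] N) ⧸ AddSubgroup.closure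
    {z : T ⊗[ℤ] N | ∃ (t : T) (b : RightEnd A T) (n : N),
      z = (b.unop t) ⊗ₜ[ℤ] n - t ⊗ₜ[ℤ] (b • n)}

/-- The class `𝒳(T)` of all `B`-modules `N` of finite length such that `T ⊗_B N = 0`, where
`B = End_A(T)` operates on the right of `T`. -/
def classX (A : Type u) [Ring A] (T : Type u) [AddCommGroup T] [Module A T] :
    ObjectProperty (ModuleCat.{u} (RightEnd A T)) := fun N =>
  IsFiniteLength (RightEnd A T) N ∧ Subsingleton (TensorRightEnd A T N)

/-! ### The module `DA` -/

/-- `DA = Hom_k(A, k)`, where `k` is the center of `A`. -/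
def DualRegular (A : Type u) [Ring A] : Type u :=
  A →ₗ[Subring.center A] Subring.center A

instance (A : Type u) [Ring A] : AddCommGroup (DualRegular A) :=
  inferInstanceAs (AddCommGroup (A →ₗ[Subring.center A] Subring.center A))

/-- An element of `DA`, as a linear map. -/
def DualRegular.toLin {A : Type u} [Ring A] (f : DualRegular A) :
    A →ₗ[Subring.center A] Subring.center A := f

/-- The left `A`-module structure on `DA`: `(a f)(x) = f (x a)`. -/
instance (A : Type u) [Ring A] : Module A (DualRegular A) where
  smul a f :=
    { toFun := fun x => f.toLin (x * a)
      map_add' := fun x y => by rw [add_mul, map_add]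
      map_smul' := fun c x => by rw [smul_mul_assoc, map_smul]; rfl }
  one_smul f := LinearMap.ext fun x =>
    congrArg f.toLin (mul_one x)
  mul_smul a b f := LinearMap.ext fun x =>
    congrArg f.toLin (mul_assoc x a b).symm
  smul_zero _ := rfl
  smul_add _ _ _ := rfl
  add_smul a b f := LinearMap.ext fun x =>
    (congrArg f.toLin (mul_add x a b)).trans
      (map_add f.toLin _ _)
  zero_smul f := LinearMap.ext fun x =>
    (congrArg f.toLin (mul_zero x)).trans
      (map_zero f.toLin)

/-- The right operation of `a` on `DA`, `(f a)(x) = f (a x)`, as an endomorphism of the left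
`A`-module `DA`. -/
def dualRegularMul (A : Type u) [Ring A] (a : A) : Module.End A (DualRegular A) where
  toFun f :=
    { toFun := fun x => f.toLin (a * x)
      map_add' := fun x y => by rw [mul_add, map_add]
      map_smul' := fun c x => by rw [mul_smul_comm, map_smul]; rfl }
  map_add' _ _ := rfl
  map_smul' b f := LinearMap.ext fun x =>
    congrArg f.toLin (mul_assoc a x b)

/-- The canonical ring homomorphism from `A` to the ring of endomorphisms of `DA` operating on
the right. -/
def toRightEndDual (A : Type u) [Ring A] : A →+* RightEnd A (DualRegular A) where
  toFun a := MulOpposite.op (dualRegularMul A a)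
  map_one' := MulOpposite.unop_injective <| LinearMap.ext fun f => LinearMap.ext fun x =>
    congrArg f.toLin (one_mul x)
  map_mul' a b := MulOpposite.unop_injective <| LinearMap.ext fun f => LinearMap.ext fun x =>
    congrArg f.toLin (mul_assoc a b x)
  map_zero' := MulOpposite.unop_injective <| LinearMap.ext fun f => LinearMap.ext fun x =>
    (congrArg f.toLin (zero_mul x)).trans
      (map_zero f.toLin)
  map_add' a b := MulOpposite.unop_injective <| LinearMap.ext fun f => LinearMap.ext fun x =>
    (congrArg f.toLin (add_mul a b x)).trans
      (map_add f.toLin _ _)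

/-- The class `𝒳(DA)`, regarded as a class of left `A`-modules along the canonical ring
homomorphism from `A` to the endomorphism ring of `DA`. -/
def classXDual (A : Type u) [Ring A] : ObjectProperty (ModuleCat.{u} A) :=
  (classX A (DualRegular A)).map (ModuleCat.restrictScalars.{u} (toRightEndDual A))

/-- The class of all left `A`-modules of finite length without an indecomposable projective direct
summand. -/
def classNoProjectiveSummand (A : Type u) [Ring A] : ObjectProperty (ModuleCat.{u} A) := fun M =>
  IsFiniteLength A M ∧ ∀ U V : Submodule A M, IsCompl U V →
    ¬ (IsIndecomposableModule A U ∧ Module.Projective A U)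

end

/-! ### Hereditary rings -/

section Hereditary

variable {R : Type u} [Ring R]

/-! All three classes coincide with the modules `M` of finite length that satisfy `Hom_A(M, A) = 0`;
the characterizations are `classXDual_iff`, `classNoProjectiveSummand_iff` and `classW_iff`.

For `𝒳(DA)`: the center `k` is reduced and artinian, hence semisimple, so `k`-duality is exact and
reflexive on finite modules. It gives `End(DA) = A` on the right, the injectivity of `DA`, and an
identification of the `k`-dual of `DA ⊗ N` with `Hom_A(N, A)`. For projective summands: the image of
a nonzero form `M → A` is a left ideal, hence projective, and so splits off.

For `𝒲(A)`: if `N = F/K` with `F` finite free, then `K` is projective and `Ext¹(N, A)` is the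
cokernel of `F* → K*`. A form on it is an element of `K** = K` killed by all forms on `F`, hence
zero. Conversely, if `M = F/K` has no nonzero forms, then `F* → K*` is injective with some cokernel
`N`, and dualizing again gives `Ext¹(N, A) = F/K = M`.

Closed implies Nakayama: embed a finite projective `P` into a finite injective `E` and divide `E` by
the smallest kernel of a map to a free module. The kernel has no nonzero forms, so by closedness
neither has its intersection with `P`, which is projective and hence zero. Thus `P` embeds into a
module that is both projective and injective (`exists_projective_injective_of_closed`). Uniformity
of indecomposable injectives and locality of indecomposable projectives then give uniseriality.

Nakayama implies closed: a submodule of `M` with a nonzero form contains an indecomposable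
projective `P`. Some map from `M` to an indecomposable injective is injective on `P`; its image is
uniserial and contains a copy of `P`, which forces it to embed into a free module
(`IsUniserialModule.exists_injective_of_projective`). So `M` has a nonzero form. -/

theorem exists_split_of_finite_projective (P : Type u) [AddCommGroup P] [Module R P]
    [Module.Finite R P] [Module.Projective R P] :
    ∃ (n : ℕ) (i : P →ₗ[R] (Fin n → R)) (p : (Fin n → R) →ₗ[R] P), p ∘ₗ i = LinearMap.id := by
  obtain ⟨n, p, hp⟩ := Module.Finite.exists_fin' R P
  obtain ⟨i, hi⟩ := Module.projective_lifting_property p LinearMap.id hp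
  exact ⟨n, i, p, hi⟩

theorem projective_of_projective_ker_range {M N : Type u} [AddCommGroup M] [Module R M]
    [AddCommGroup N] [Module R N] (g : M →ₗ[R] N) [Module.Projective R (LinearMap.ker g)]
    [Module.Projective R (LinearMap.range g)] : Module.Projective R M := by
  obtain ⟨s, hs⟩ := Module.projective_lifting_property g.rangeRestrict LinearMap.id
    g.surjective_rangeRestrict
  have hs' (y : LinearMap.range g) : g (s y) = y :=
    congrArg Subtype.val (LinearMap.congr_fun hs y)
  let q : M →ₗ[R] LinearMap.ker g :=
    (LinearMap.id - s ∘ₗ g.rangeRestrict).codRestrict _ fun m => by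
      simp [hs']
  refine Module.Projective.of_split (q.prod g.rangeRestrict)
    ((LinearMap.ker g).subtype.coprod s) ?_
  ext m
  simp [q]

/-- Induction on the number of coordinates: the image of the first coordinate is a left ideal, and
its kernel embeds through the remaining ones. -/
theorem projective_of_injective_pi (hR : ∀ I : Submodule R R, Module.Projective R I) (n : ℕ) :
    ∀ (M : Type u) [AddCommGroup M] [Module R M] (f : M →ₗ[R] (Fin n → R)),
      Function.Injective f → Module.Projective R M := by
  induction n with
  | zero =>
    intro M _ _ f hf
    have : Subsingleton M := hf.subsingleton
    exact Module.Projective.of_split (0 : M →ₗ[R] R) 0 (Subsingleton.elim _ _)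
  | succ n ih =>
    intro M _ _ f hf
    let g : M →ₗ[R] R := LinearMap.proj 0 ∘ₗ f
    have h1 : Module.Projective R (LinearMap.range g) := hR _
    have h2 : Module.Projective R (LinearMap.ker g) := by
      refine ih _ (LinearMap.pi (fun i => LinearMap.proj i.succ ∘ₗ f) ∘ₗ
        (LinearMap.ker g).subtype) fun x y hxy => Subtype.ext (hf (funext fun i => ?_))
      refine Fin.cases ?_ (fun j => congrFun hxy j) i
      exact (LinearMap.mem_ker.1 x.2).trans (LinearMap.mem_ker.1 y.2).symm
    exact projective_of_projective_ker_range g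

theorem projective_of_injective (hR : ∀ I : Submodule R R, Module.Projective R I)
    {M P : Type u} [AddCommGroup M] [Module R M] [AddCommGroup P] [Module R P]
    [Module.Finite R P] [Module.Projective R P] (f : M →ₗ[R] P) (hf : Function.Injective f) :
    Module.Projective R M := by
  obtain ⟨n, i, p, hip⟩ := exists_split_of_finite_projective (R := R) P
  refine projective_of_injective_pi hR n M (i ∘ₗ f) ?_
  exact (LinearMap.injective_of_comp_eq_id i p hip).comp hf

theorem injective_of_split {M E : Type u} [AddCommGroup M] [Module R M] [AddCommGroup E]
    [Module R E] [Module.Injective R E] (i : M →ₗ[R] E) (s : E →ₗ[R] M)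
    (h : s ∘ₗ i = LinearMap.id) : Module.Injective R M where
  out X Y _ _ _ _ f hf g := by
    obtain ⟨t, ht⟩ := Module.Injective.out f hf (i ∘ₗ g)
    exact ⟨s ∘ₗ t, fun x => by
      simpa [ht] using LinearMap.congr_fun h (g x)⟩

theorem exists_retraction_of_injective {M E : Type u} [AddCommGroup M] [Module R M]
    [AddCommGroup E] [Module R E] [Module.Injective R M] (i : M →ₗ[R] E)
    (hi : Function.Injective i) : ∃ s : E →ₗ[R] M, s ∘ₗ i = LinearMap.id := by
  obtain ⟨s, hs⟩ := Module.Injective.out i hi (LinearMap.id (R := R) (M := M))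
  exact ⟨s, LinearMap.ext hs⟩

/-- Baer's criterion: a map from a left ideal to the quotient lifts to `E` because the ideal is
projective, extends to `R` because `E` is injective, and is pushed down again. -/
theorem injective_of_surjective (hR : ∀ I : Submodule R R, Module.Projective R I)
    {M E : Type u} [AddCommGroup M] [Module R M] [AddCommGroup E] [Module R E]
    [Module.Injective R E] (f : E →ₗ[R] M) (hf : Function.Surjective f) :
    Module.Injective R M := by
  refine Module.Baer.injective fun I g => ?_
  have := hR I
  obtain ⟨h, hh⟩ := Module.projective_lifting_property f g hf
  obtain ⟨t, ht⟩ := Module.Injective.out I.subtype I.subtype_injective h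
  exact ⟨f ∘ₗ t, fun x hx => by
    have := ht ⟨x, hx⟩
    simp only [Submodule.subtype_apply] at this
    rw [LinearMap.comp_apply, this]
    exact LinearMap.congr_fun hh _⟩

end Hereditary

/-! ### Indecomposable modules of finite length -/

section Indecomposable

variable {R : Type u} [Ring R]

/-- Fitting's lemma: the kernel and range of a high power of `f` are complementary. -/
theorem IsIndecomposableModule.bijective_or_isNilpotent {M : Type u} [AddCommGroup M] [Module R M]
    [IsNoetherian R M] [IsArtinian R M] (hM : IsIndecomposableModule R M) (f : Module.End R M) :
    Function.Bijective f ∨ IsNilpotent f := by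
  obtain ⟨n, hn⟩ := Filter.eventually_atTop.1 f.eventually_isCompl_ker_pow_range_pow
  have h := hn (n + 1) (Nat.le_succ n)
  rcases hM.2 _ _ h with h0 | h0
  · left
    have hinj : Function.Injective f := by
      rw [← LinearMap.ker_eq_bot, eq_bot_iff, ← h0]
      intro x hx
      rw [LinearMap.mem_ker] at hx ⊢
      rw [pow_succ, Module.End.mul_apply, hx, map_zero]
    exact IsArtinian.bijective_of_injective_endomorphism f hinj
  · right
    exact ⟨n + 1, LinearMap.range_eq_bot.1 h0⟩

theorem IsIndecomposableModule.bijective_of_add_eq_one {M : Type u} [AddCommGroup M] [Module R M]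
    [IsNoetherian R M] [IsArtinian R M] (hM : IsIndecomposableModule R M) (f g : Module.End R M)
    (h : f + g = 1) : Function.Bijective f ∨ Function.Bijective g := by
  refine (hM.bijective_or_isNilpotent f).imp_right fun hf => ?_
  rw [← Module.End.isUnit_iff, eq_sub_of_add_eq' h]
  exact hf.isUnit_one_sub

/-- An indecomposable injective module of finite length is uniform. -/
theorem IsIndecomposableModule.eq_bot_or_eq_bot_of_disjoint {E : Type u} [AddCommGroup E]
    [Module R E] [IsNoetherian R E] [IsArtinian R E] [Module.Injective R E]
    (hE : IsIndecomposableModule R E) {U V : Submodule R E} (h : Disjoint U V) :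
    U = ⊥ ∨ V = ⊥ := by
  -- A retraction of `E → E/U × E/V` writes the identity as a sum of two endomorphisms, one killing
  -- `U` and the other killing `V`; one of them is bijective.
  have hinj : Function.Injective (U.mkQ.prod V.mkQ) := by
    rw [← LinearMap.ker_eq_bot, LinearMap.ker_prod, Submodule.ker_mkQ, Submodule.ker_mkQ]
    exact h.eq_bot
  obtain ⟨s, hs⟩ := exists_retraction_of_injective _ hinj
  have key := hE.bijective_of_add_eq_one (s ∘ₗ LinearMap.inl R _ _ ∘ₗ U.mkQ)
    (s ∘ₗ LinearMap.inr R _ _ ∘ₗ V.mkQ) (by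
      ext x
      have := LinearMap.congr_fun hs x
      simp only [LinearMap.add_apply, LinearMap.comp_apply, ← map_add] at this ⊢
      simpa using this)
  refine key.imp (fun hb => ?_) (fun hb => ?_)
  · rw [eq_bot_iff]
    intro x hx
    refine hb.1 ?_
    have : U.mkQ x = 0 := by simpa using hx
    simp only [LinearMap.comp_apply, this, map_zero]
  · rw [eq_bot_iff]
    intro x hx
    refine hb.1 ?_
    have : V.mkQ x = 0 := by simpa using hx
    simp only [LinearMap.comp_apply, this, map_zero]

/-- An indecomposable projective module of finite length is local. -/
theorem IsIndecomposableModule.eq_top_or_eq_top_of_codisjoint {P : Type u} [AddCommGroup P]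
    [Module R P] [IsNoetherian R P] [IsArtinian R P] [Module.Projective R P]
    (hP : IsIndecomposableModule R P) {U V : Submodule R P} (h : Codisjoint U V) :
    U = ⊤ ∨ V = ⊤ := by
  have hsurj : Function.Surjective (U.subtype.coprod V.subtype) := by
    rw [← LinearMap.range_eq_top, LinearMap.range_coprod, Submodule.range_subtype,
      Submodule.range_subtype]
    exact h.eq_top
  obtain ⟨s, hs⟩ := Module.projective_lifting_property _ LinearMap.id hsurj
  have key := hP.bijective_of_add_eq_one (U.subtype ∘ₗ LinearMap.fst R _ _ ∘ₗ s)
    (V.subtype ∘ₗ LinearMap.snd R _ _ ∘ₗ s) (by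
      ext x
      simpa using LinearMap.congr_fun hs x)
  refine key.imp (fun hb => ?_) (fun hb => ?_)
  · rw [eq_top_iff]
    intro x _
    obtain ⟨y, rfl⟩ := hb.2 x
    simp
  · rw [eq_top_iff]
    intro x _
    obtain ⟨y, rfl⟩ := hb.2 x
    simp

theorem IsUniserialModule.isIndecomposableModule {M : Type u} [AddCommGroup M] [Module R M]
    [Nontrivial M] (hM : IsUniserialModule R M) : IsIndecomposableModule R M := by
  refine ⟨inferInstance, fun U V h => ?_⟩
  rcases hM U V with h1 | h1
  · exact Or.inl (h.disjoint.eq_bot_of_le h1)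
  · exact Or.inr (h.disjoint.symm.eq_bot_of_le h1)

theorem IsUniserialModule.of_injective {M N : Type u} [AddCommGroup M] [Module R M]
    [AddCommGroup N] [Module R N] (hN : IsUniserialModule R N) (f : M →ₗ[R] N)
    (hf : Function.Injective f) : IsUniserialModule R M := fun U V => by
  simpa only [Submodule.map_le_map_iff_of_injective hf] using hN (U.map f) (V.map f)

theorem IsUniserialModule.of_surjective {M N : Type u} [AddCommGroup M] [Module R M]
    [AddCommGroup N] [Module R N] (hM : IsUniserialModule R M) (f : M →ₗ[R] N)
    (hf : Function.Surjective f) : IsUniserialModule R N := fun U V => by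
  simpa only [Submodule.comap_le_comap_iff_of_surjective hf] using hM (U.comap f) (V.comap f)

theorem isIndecomposableModule_congr {M N : Type u} [AddCommGroup M] [Module R M]
    [AddCommGroup N] [Module R N] (e : M ≃ₗ[R] N) (hM : IsIndecomposableModule R M) :
    IsIndecomposableModule R N := by
  have := hM.1
  refine ⟨e.symm.toEquiv.nontrivial, fun U V h => ?_⟩
  exact (hM.2 _ _ ((Submodule.orderIsoMapComap e).symm.isCompl h)).imp
    (map_eq_bot_iff (Submodule.orderIsoMapComap e).symm).1
    (map_eq_bot_iff (Submodule.orderIsoMapComap e).symm).1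

/-- A property of submodules that passes to a member of each decomposition holds for some
indecomposable submodule. -/
theorem exists_isIndecomposableModule {M : Type u} [AddCommGroup M] [Module R M]
    [IsArtinian R M] (Q : Submodule R M → Prop) (h0 : ¬ Q ⊥)
    (hQ : ∀ U, Q U → ∀ X Y : Submodule R U, IsCompl X Y →
      Q (X.map U.subtype) ∨ Q (Y.map U.subtype))
    (U₀ : Submodule R M) (hU₀ : Q U₀) :
    ∃ U, Q U ∧ IsIndecomposableModule R U := by
  obtain ⟨U, hU, hmin⟩ := IsArtinian.set_has_minimal {U | Q U} ⟨U₀, hU₀⟩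
  have key (X : Submodule R U) (hX : Q (X.map U.subtype)) : X = ⊤ := by
    by_contra hne
    refine hmin _ hX (lt_of_le_of_ne (Submodule.map_subtype_le U X) fun h => hne ?_)
    refine Submodule.map_injective_of_injective U.subtype_injective ?_
    rw [h, Submodule.map_subtype_top]
  refine ⟨U, hU, ?_, fun X Y h => ?_⟩
  · rw [Submodule.nontrivial_iff_ne_bot]
    rintro rfl
    exact h0 hU
  · rcases hQ U hU X Y h with h1 | h1
    · exact Or.inr (by simpa [key X h1] using h.disjoint.symm.eq_bot_of_le (key X h1 ▸ le_top))
    · exact Or.inl (by simpa [key Y h1] using h.disjoint.eq_bot_of_le (key Y h1 ▸ le_top))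

theorem projective_map_subtype {M : Type u} [AddCommGroup M] [Module R M]
    {U : Submodule R M} {X Y : Submodule R U} (h : IsCompl X Y) [Module.Projective R U] :
    Module.Projective R ↥(X.map U.subtype) := by
  have : Module.Projective R X := Module.Projective.of_split X.subtype (X.projectionOnto Y h)
    (LinearMap.ext fun x => by simp)
  exact Module.Projective.of_equiv (X.equivMapOfInjective U.subtype U.subtype_injective)

theorem injective_map_subtype {M : Type u} [AddCommGroup M] [Module R M]
    {U : Submodule R M} {X Y : Submodule R U} (h : IsCompl X Y) [Module.Injective R U] :
    Module.Injective R ↥(X.map U.subtype) := by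
  let e := X.equivMapOfInjective U.subtype U.subtype_injective
  refine injective_of_split (X.subtype ∘ₗ e.symm.toLinearMap)
    (e.toLinearMap ∘ₗ X.projectionOnto Y h) (LinearMap.ext fun x => ?_)
  simp

/-- A linear map into `U = X ⊕ Y` that does not vanish at a point has a component that does not
vanish there. -/
theorem exists_apply_ne_zero_of_isCompl {L M : Type u} [AddCommGroup L] [Module R L]
    [AddCommGroup M] [Module R M] {U : Submodule R M} {X Y : Submodule R U} (h : IsCompl X Y)
    (f : L →ₗ[R] U) {x : L} (hx : f x ≠ 0) :
    (∃ g : L →ₗ[R] ↥(X.map U.subtype), g x ≠ 0) ∨ ∃ g : L →ₗ[R] ↥(Y.map U.subtype), g x ≠ 0 := by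
  by_contra! hc
  have h1 := hc.1 ((X.equivMapOfInjective U.subtype U.subtype_injective).toLinearMap ∘ₗ
    X.projectionOnto Y h ∘ₗ f)
  have h2 := hc.2 ((Y.equivMapOfInjective U.subtype U.subtype_injective).toLinearMap ∘ₗ
    Y.projectionOnto X h.symm ∘ₗ f)
  simp only [LinearMap.comp_apply, LinearEquiv.coe_coe, LinearEquiv.map_eq_zero_iff,
    Submodule.projectionOnto_apply_eq_zero_iff] at h1 h2
  exact hx ((Submodule.mem_bot R).1 (h.inf_eq_bot ▸ ⟨h2, h1⟩))

theorem map_sup_map_of_isCompl {M N : Type u} [AddCommGroup M] [Module R M] [AddCommGroup N]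
    [Module R N] (f : M →ₗ[R] N) {U : Submodule R M} {X Y : Submodule R U} (h : IsCompl X Y) :
    (X.map U.subtype).map f ⊔ (Y.map U.subtype).map f = U.map f := by
  rw [← Submodule.map_sup, ← Submodule.map_sup, h.sup_eq_top, Submodule.map_subtype_top]

theorem isCompl_ker_range_of_comp_eq_id {M N : Type u} [AddCommGroup M] [Module R M]
    [AddCommGroup N] [Module R N] {f : M →ₗ[R] N} {s : N →ₗ[R] M} (h : f ∘ₗ s = LinearMap.id) :
    IsCompl (LinearMap.ker f) (LinearMap.range s) := by
  have h' (y : N) : f (s y) = y := LinearMap.congr_fun h y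
  refine ⟨Submodule.disjoint_def.2 ?_, codisjoint_iff.2 (eq_top_iff.2 fun x _ => ?_)⟩
  · rintro _ hx ⟨y, rfl⟩
    rw [LinearMap.mem_ker, h'] at hx
    rw [hx, map_zero]
  · rw [← sub_add_cancel x (s (f x))]
    exact Submodule.add_mem_sup (by simp [h']) ⟨f x, rfl⟩

/-- A map from an indecomposable module with projective range is injective or zero. -/
theorem IsIndecomposableModule.injective_of_projective_range {M N : Type u} [AddCommGroup M]
    [Module R M] [AddCommGroup N] [Module R N] (hM : IsIndecomposableModule R M) (f : M →ₗ[R] N)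
    [Module.Projective R (LinearMap.range f)] (hf : f ≠ 0) : Function.Injective f := by
  obtain ⟨s, hs⟩ := Module.projective_lifting_property f.rangeRestrict LinearMap.id
    f.surjective_rangeRestrict
  rcases hM.2 _ _ (isCompl_ker_range_of_comp_eq_id hs) with h | h
  · rwa [LinearMap.ker_rangeRestrict, LinearMap.ker_eq_bot] at h
  · refine (hf (LinearMap.ext fun x => ?_)).elim
    have h1 : s (f.rangeRestrict x) = 0 := (Submodule.mem_bot R).1 (h ▸ ⟨_, rfl⟩)
    have h2 := LinearMap.congr_fun hs (f.rangeRestrict x)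
    rw [LinearMap.comp_apply, h1, map_zero] at h2
    exact (congrArg Subtype.val h2).symm

end Indecomposable

/-! ### Uniserial modules over hereditary rings with enough finite injective modules -/

section Uniserial

variable {R : Type u} [Ring R]

theorem exists_linearMap_apply_ne_zero (P : Type u) [AddCommGroup P] [Module R P]
    [Module.Finite R P] [Module.Projective R P] {x : P} (hx : x ≠ 0) :
    ∃ f : P →ₗ[R] R, f x ≠ 0 := by
  obtain ⟨n, i, p, hip⟩ := exists_split_of_finite_projective (R := R) P
  have hix : i x ≠ 0 := fun h => hx (LinearMap.injective_of_comp_eq_id i p hip (by simpa using h))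
  obtain ⟨k, hk⟩ := Function.ne_iff.1 hix
  exact ⟨LinearMap.proj k ∘ₗ i, hk⟩

/-- A nonzero artinian uniserial module has a nonzero element that belongs to all nonzero
submodules. -/
theorem IsUniserialModule.exists_mem_of_ne_bot {M : Type u} [AddCommGroup M] [Module R M]
    [IsArtinian R M] [Nontrivial M] (hM : IsUniserialModule R M) :
    ∃ x : M, x ≠ 0 ∧ ∀ N : Submodule R M, N ≠ ⊥ → x ∈ N := by
  obtain ⟨S, hS, hmin⟩ := IsArtinian.set_has_minimal {N : Submodule R M | N ≠ ⊥} ⟨⊤, top_ne_bot⟩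
  obtain ⟨x, hxS, hx⟩ := S.ne_bot_iff.1 hS
  refine ⟨x, hx, fun N hN => ?_⟩
  rcases hM N S with h | h
  · rcases h.lt_or_eq with h1 | h1
    · exact (hmin N hN h1).elim
    · exact h1 ▸ hxS
  · exact h hxS

/-- A finite uniserial module with a nonzero projective submodule is projective, if the
indecomposable projective modules are uniserial. -/
theorem IsUniserialModule.exists_injective_of_projective [IsNoetherianRing R] [IsArtinianRing R]
    (hproj : ∀ (P : Type u) [AddCommGroup P] [Module R P], Module.Finite R P →
      Module.Projective R P → IsIndecomposableModule R P → IsUniserialModule R P)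
    {J P : Type u} [AddCommGroup J] [Module R J] [Module.Finite R J] [AddCommGroup P]
    [Module R P] [Module.Projective R P] [Nontrivial P] (hJ : IsUniserialModule R J)
    (k : P →ₗ[R] J) (hk : Function.Injective k) :
    ∃ (n : ℕ) (f : J →ₗ[R] (Fin n → R)), Function.Injective f := by
  have : Nontrivial J := hk.nontrivial
  obtain ⟨n, φ, hφ⟩ := Module.Finite.exists_fin' R J
  -- When a projective submodule that maps onto `J` decomposes, the images of the two summands are
  -- comparable, so one summand alone maps onto `J`.
  obtain ⟨U, ⟨hU, hUJ⟩, hUi⟩ := exists_isIndecomposableModule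
    (fun U : Submodule R (Fin n → R) => Module.Projective R U ∧ U.map φ = ⊤)
    (fun h => by simpa using h.2) (fun U hU X Y h => by
      have hp := hU.1
      rcases hJ ((X.map U.subtype).map φ) ((Y.map U.subtype).map φ) with h1 | h1
      · refine Or.inr ⟨projective_map_subtype h.symm, ?_⟩
        rw [← hU.2, ← map_sup_map_of_isCompl φ h, sup_eq_right.2 h1]
      · refine Or.inl ⟨projective_map_subtype h, ?_⟩
        rw [← hU.2, ← map_sup_map_of_isCompl φ h, sup_eq_left.2 h1]) ⊤
    ⟨Module.Projective.of_equiv Submodule.topEquiv.symm, by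
      rw [Submodule.map_top, LinearMap.range_eq_top.2 hφ]⟩
  have hUu := hproj U inferInstance hU hUi
  let ψ : U →ₗ[R] J := φ ∘ₗ U.subtype
  have hψ : Function.Surjective ψ := by
    rw [← LinearMap.range_eq_top, LinearMap.range_comp, Submodule.range_subtype, hUJ]
  -- The preimage of the copy of `P` is uniserial, hence indecomposable, and maps onto a projective
  -- module, so this map is injective. As `N` contains the kernel of `ψ`, the map `ψ` is injective
  -- too.
  let N : Submodule R U := (LinearMap.range k).comap ψ
  let χ : N →ₗ[R] LinearMap.range k := ψ.restrict fun x hx => hx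
  have hχ : Function.Surjective χ := by
    rintro ⟨y, hy⟩
    obtain ⟨x, rfl⟩ := hψ y
    exact ⟨⟨x, hy⟩, rfl⟩
  have : Module.Projective R (LinearMap.range k) :=
    Module.Projective.of_equiv (LinearEquiv.ofInjective k hk)
  have : Nontrivial (LinearMap.range k) := (LinearEquiv.ofInjective k hk).symm.toEquiv.nontrivial
  have : Nontrivial N := hχ.nontrivial
  have hN : IsIndecomposableModule R N :=
    (hUu.of_injective N.subtype N.subtype_injective).isIndecomposableModule
  have hrange : LinearMap.range χ = ⊤ := LinearMap.range_eq_top.2 hχ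
  have : Module.Projective R (LinearMap.range χ) := by
    rw [hrange]
    exact Module.Projective.of_equiv Submodule.topEquiv.symm
  have hχi : Function.Injective χ := hN.injective_of_projective_range χ (by
    rintro h
    rw [h, LinearMap.range_zero] at hrange
    exact bot_ne_top hrange)
  have hψi : Function.Injective ψ := by
    rw [injective_iff_map_eq_zero]
    intro x hx
    have hxN : x ∈ N := by
      change ψ x ∈ LinearMap.range k
      rw [hx]
      exact zero_mem _
    exact congrArg Subtype.val (hχi (a₁ := ⟨x, hxN⟩) (a₂ := 0) (Subtype.ext (by simpa [χ] using hx)))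
  exact ⟨n, U.subtype ∘ₗ (LinearEquiv.ofBijective ψ ⟨hψi, hψ⟩).symm.toLinearMap,
    U.subtype_injective.comp (LinearEquiv.injective _)⟩

/-- If the indecomposable projective modules and the indecomposable injective modules are
uniserial, a finite module with a nonzero projective submodule has a nonzero linear form. -/
theorem exists_linearMap_ne_zero_of_uniserial [IsNoetherianRing R] [IsArtinianRing R]
    (hE : ∀ (M : Type u) [AddCommGroup M] [Module R M], Module.Finite R M →
      ∃ (E : Type u) (_ : AddCommGroup E) (_ : Module R E), Module.Finite R E ∧
        Module.Injective R E ∧ ∃ g : M →ₗ[R] E, Function.Injective g)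
    (hproj : ∀ (P : Type u) [AddCommGroup P] [Module R P], Module.Finite R P →
      Module.Projective R P → IsIndecomposableModule R P → IsUniserialModule R P)
    (hinj : ∀ (I : Type u) [AddCommGroup I] [Module R I], Module.Finite R I →
      Module.Injective R I → IsIndecomposableModule R I → IsUniserialModule R I)
    {M P : Type u} [AddCommGroup M] [Module R M] [Module.Finite R M] [AddCommGroup P]
    [Module R P] [Module.Finite R P] [Module.Projective R P] (hP : IsIndecomposableModule R P)
    (j : P →ₗ[R] M) (hj : Function.Injective j) : ∃ f : M →ₗ[R] R, f ≠ 0 := by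
  have := hP.1
  obtain ⟨s, hs, hsN⟩ := (hproj P inferInstance inferInstance hP).exists_mem_of_ne_bot
  obtain ⟨E, _, _, hEf, hEi, g, hg⟩ := hE M inferInstance
  -- Since `s` lies in every nonzero submodule of `P`, a map that does not kill `j s` is injective
  -- on `P`; it suffices to keep a summand on which `s` survives.
  obtain ⟨U, ⟨hU, h, hh⟩, hUi⟩ := exists_isIndecomposableModule
    (fun U : Submodule R E => Module.Injective R U ∧ ∃ h : M →ₗ[R] U, h (j s) ≠ 0)
    (fun ⟨_, h, hh⟩ => hh (Subsingleton.elim _ _)) (fun U hU X Y hXY => by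
      obtain ⟨hUi, h, hh⟩ := hU
      exact (exists_apply_ne_zero_of_isCompl hXY h hh).imp
        (fun h' => ⟨injective_map_subtype hXY, h'⟩)
        (fun h' => ⟨injective_map_subtype hXY.symm, h'⟩)) ⊤
    ⟨injective_of_split (Submodule.topEquiv (R := R) (M := E)).toLinearMap
        Submodule.topEquiv.symm.toLinearMap (by ext; simp),
      Submodule.topEquiv.symm.toLinearMap ∘ₗ g, by
        simpa [map_eq_zero_iff _ hg, map_eq_zero_iff _ hj] using hs⟩
  have hUu := hinj U inferInstance hU hUi
  have hk : Function.Injective (h.rangeRestrict ∘ₗ j) := by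
    rw [← LinearMap.ker_eq_bot]
    by_contra hne
    exact hh (congrArg Subtype.val (LinearMap.mem_ker.1 (hsN _ hne)))
  obtain ⟨n, f, hf⟩ := (hUu.of_injective (LinearMap.range h).subtype
    (Submodule.subtype_injective _)).exists_injective_of_projective hproj _ hk
  have hne : f (h.rangeRestrict (j s)) ≠ 0 := fun h0 =>
    hh (congrArg Subtype.val (hf (h0.trans (map_zero f).symm)))
  obtain ⟨i, hi⟩ := Function.ne_iff.1 hne
  exact ⟨LinearMap.proj i ∘ₗ f ∘ₗ h.rangeRestrict, fun h0 => hi (LinearMap.congr_fun h0 (j s))⟩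

/-- A module with a nonzero linear form has an indecomposable left ideal as a retract. -/
theorem exists_retract_of_linearMap_ne_zero [IsNoetherianRing R] [IsArtinianRing R]
    (hR : ∀ I : Submodule R R, Module.Projective R I) {M : Type u} [AddCommGroup M] [Module R M]
    (f : M →ₗ[R] R) (hf : f ≠ 0) :
    ∃ U : Submodule R R, IsIndecomposableModule R U ∧
      ∃ (j : U →ₗ[R] M) (p : M →ₗ[R] U), p ∘ₗ j = LinearMap.id := by
  have := hR (LinearMap.range f)
  obtain ⟨s, hs⟩ := Module.projective_lifting_property f.rangeRestrict LinearMap.id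
    f.surjective_rangeRestrict
  obtain ⟨U, ⟨-, p, j, hjp⟩, hUi⟩ := exists_isIndecomposableModule
    (fun U : Submodule R R => U ≠ ⊥ ∧ ∃ (p : LinearMap.range f →ₗ[R] U)
      (j : U →ₗ[R] LinearMap.range f), p ∘ₗ j = LinearMap.id) (by simp)
    (fun U hU X Y h => by
      obtain ⟨hU0, p, j, hpj⟩ := hU
      have aux {X Y : Submodule R U} (h : IsCompl X Y) (hX : X ≠ ⊥) :
          X.map U.subtype ≠ ⊥ ∧ ∃ (p : LinearMap.range f →ₗ[R] ↥(X.map U.subtype))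
            (j : ↥(X.map U.subtype) →ₗ[R] LinearMap.range f), p ∘ₗ j = LinearMap.id := by
        refine ⟨fun h0 => hX (Submodule.map_injective_of_injective U.subtype_injective
          (by rw [h0, Submodule.map_bot])), ?_⟩
        let e := X.equivMapOfInjective U.subtype U.subtype_injective
        refine ⟨e.toLinearMap ∘ₗ X.projectionOnto Y h ∘ₗ p,
          j ∘ₗ X.subtype ∘ₗ e.symm.toLinearMap, LinearMap.ext fun x => ?_⟩
        have := LinearMap.congr_fun hpj (e.symm x : U)
        simp only [LinearMap.comp_apply, LinearMap.id_apply] at this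
        simp [this]
      by_cases hX : X = ⊥
      · refine Or.inr (aux h.symm fun hY => hU0 ?_)
        have := h.sup_eq_top
        rw [hX, hY, bot_sup_eq] at this
        have := (Submodule.subsingleton_iff R).1 (subsingleton_of_bot_eq_top this)
        exact Submodule.eq_bot_of_subsingleton
      · exact Or.inl (aux h hX)) (LinearMap.range f)
    ⟨fun h => hf (LinearMap.range_eq_bot.1 h), LinearMap.id, LinearMap.id, rfl⟩
  refine ⟨U, hUi, s ∘ₗ j, p ∘ₗ f.rangeRestrict, LinearMap.ext fun x => ?_⟩
  have h1 := LinearMap.congr_fun hs (j x)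
  have h2 := LinearMap.congr_fun hjp x
  simp only [LinearMap.comp_apply, LinearMap.id_apply] at h1 h2 ⊢
  rw [h1, h2]

/-- If the modules without nonzero linear forms are closed under submodules, finite projective
modules embed into finite projective injective modules. -/
theorem exists_projective_injective_of_closed [IsNoetherianRing R] [IsArtinianRing R]
    (hR : ∀ I : Submodule R R, Module.Projective R I)
    (hE : ∀ (M : Type u) [AddCommGroup M] [Module R M], Module.Finite R M →
      ∃ (E : Type u) (_ : AddCommGroup E) (_ : Module R E), Module.Finite R E ∧
        Module.Injective R E ∧ ∃ g : M →ₗ[R] E, Function.Injective g)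
    (hC : ∀ (M N : Type u) [AddCommGroup M] [Module R M] [AddCommGroup N] [Module R N]
      (j : N →ₗ[R] M), Module.Finite R M → Function.Injective j → (∀ f : M →ₗ[R] R, f = 0) →
      ∀ f : N →ₗ[R] R, f = 0)
    (P : Type u) [AddCommGroup P] [Module R P] [Module.Finite R P] [Module.Projective R P] :
    ∃ (Q : Type u) (_ : AddCommGroup Q) (_ : Module R Q), Module.Finite R Q ∧
      Module.Projective R Q ∧ Module.Injective R Q ∧ ∃ g : P →ₗ[R] Q, Function.Injective g := by
  obtain ⟨E, _, _, hEf, hEi, g, hg⟩ := hE P inferInstance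
  -- A minimal kernel makes its own forms vanish: the kernel is a direct summand of `E`, so a
  -- nonzero form on it extends to `E` and, used as an extra coordinate, would shrink the kernel.
  obtain ⟨X, ⟨n, f, rfl⟩, hmin⟩ := IsArtinian.set_has_minimal
    {X : Submodule R E | ∃ (n : ℕ) (f : E →ₗ[R] (Fin n → R)), LinearMap.ker f = X}
    ⟨_, 0, 0, rfl⟩
  have hQ : Module.Projective R (LinearMap.range f) :=
    projective_of_injective hR (LinearMap.range f).subtype (Submodule.subtype_injective _)
  obtain ⟨s, hs⟩ := Module.projective_lifting_property f.rangeRestrict LinearMap.id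
    f.surjective_rangeRestrict
  have hs' (y : LinearMap.range f) : f (s y) = y :=
    congrArg Subtype.val (LinearMap.congr_fun hs y)
  have hker : ∀ h : LinearMap.ker f →ₗ[R] R, h = 0 := by
    intro h
    by_contra hne
    let r : E →ₗ[R] LinearMap.ker f :=
      (LinearMap.id - s ∘ₗ f.rangeRestrict).codRestrict _ fun x => by simp [hs']
    let f' : E →ₗ[R] (Fin (n + 1) → R) :=
      LinearMap.pi (Fin.cons (h ∘ₗ r) fun i => LinearMap.proj i ∘ₗ f)
    have hle : LinearMap.ker f' ≤ LinearMap.ker f := by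
      intro x hx
      refine funext fun i => ?_
      simpa [f'] using congrFun (LinearMap.mem_ker.1 hx) i.succ
    refine hmin _ ⟨n + 1, f', rfl⟩ (lt_of_le_of_ne hle fun heq => hne (LinearMap.ext fun x => ?_))
    have hx : (x : E) ∈ LinearMap.ker f' := heq.ge x.2
    have hrx : r x = x := by
      have hfx : f.rangeRestrict x = 0 := Subtype.ext x.2
      exact Subtype.ext (by simp [r, hfx])
    simpa [f', hrx] using congrFun (LinearMap.mem_ker.1 hx) 0
  refine ⟨LinearMap.range f, inferInstance, inferInstance, inferInstance, hQ,
    injective_of_split s f.rangeRestrict hs, f.rangeRestrict ∘ₗ g, ?_⟩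
  let K : Submodule R P := LinearMap.ker (f.rangeRestrict ∘ₗ g)
  have hK : Module.Projective R K := projective_of_injective hR K.subtype K.subtype_injective
  let j : K →ₗ[R] LinearMap.ker f :=
    (g ∘ₗ K.subtype).codRestrict _ fun x => congrArg Subtype.val (LinearMap.mem_ker.1 x.2)
  have hj : Function.Injective j := fun x y hxy =>
    Subtype.ext (hg (congrArg Subtype.val hxy))
  have h0 := hC _ _ j inferInstance hj hker
  rw [← LinearMap.ker_eq_bot]
  refine (Submodule.eq_bot_iff _).2 fun x hx => ?_
  by_contra hne
  obtain ⟨φ, hφ⟩ := exists_linearMap_apply_ne_zero (R := R) K (x := ⟨x, hx⟩)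
    fun h => hne (congrArg Subtype.val h)
  exact hφ (by rw [h0 φ, LinearMap.zero_apply])

theorem projective_and_injective_map_subtype {M : Type u} [AddCommGroup M] [Module R M]
    {U : Submodule R M} {X Y : Submodule R U} (h : IsCompl X Y)
    (hU : Module.Projective R U ∧ Module.Injective R U) :
    Module.Projective R ↥(X.map U.subtype) ∧ Module.Injective R ↥(X.map U.subtype) :=
  have := hU.1
  have := hU.2
  ⟨projective_map_subtype h, injective_map_subtype h⟩

theorem projective_and_injective_top (M : Type u) [AddCommGroup M] [Module R M]
    [Module.Projective R M] [Module.Injective R M] :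
    Module.Projective R (⊤ : Submodule R M) ∧ Module.Injective R (⊤ : Submodule R M) :=
  ⟨Module.Projective.of_equiv Submodule.topEquiv.symm,
    injective_of_split (Submodule.topEquiv (R := R) (M := M)).toLinearMap
        Submodule.topEquiv.symm.toLinearMap (by ext; simp)⟩

/-- `P` embeds into an indecomposable injective module, which is uniform, so every nonzero submodule
of `P` is indecomposable. It is also projective, hence local; applied to `V ⊔ W`, this makes `V` and
`W` comparable. -/
theorem isUniserialModule_of_projective_of_closed [IsNoetherianRing R] [IsArtinianRing R]
    (hR : ∀ I : Submodule R R, Module.Projective R I)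
    (hQ : ∀ (P : Type u) [AddCommGroup P] [Module R P], Module.Finite R P →
      Module.Projective R P → ∃ (Q : Type u) (_ : AddCommGroup Q) (_ : Module R Q),
        Module.Finite R Q ∧ Module.Projective R Q ∧ Module.Injective R Q ∧
          ∃ g : P →ₗ[R] Q, Function.Injective g)
    (P : Type u) [AddCommGroup P] [Module R P] [Module.Finite R P] [Module.Projective R P]
    (hP : IsIndecomposableModule R P) : IsUniserialModule R P := by
  have := hP.1
  obtain ⟨Q, _, _, hQf, hQp, hQi, g, hg⟩ := hQ P inferInstance inferInstance
  obtain ⟨x, hx⟩ := exists_ne (0 : P)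
  -- Nonvanishing at one point is enough to require: `h` has projective range and `P` is
  -- indecomposable, so a nonzero `h` is injective.
  obtain ⟨U, ⟨hU, h, hh⟩, hUi⟩ := exists_isIndecomposableModule
    (fun U : Submodule R Q => (Module.Projective R U ∧ Module.Injective R U) ∧
      ∃ h : P →ₗ[R] U, h x ≠ 0)
    (fun ⟨_, h, hh⟩ => hh (Subsingleton.elim _ _)) (fun U hU X Y hXY => by
      obtain ⟨hUi, h, hh⟩ := hU
      exact (exists_apply_ne_zero_of_isCompl hXY h hh).imp
        (fun h' => ⟨projective_and_injective_map_subtype hXY hUi, h'⟩)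
        (fun h' => ⟨projective_and_injective_map_subtype hXY.symm hUi, h'⟩)) ⊤
    ⟨projective_and_injective_top Q, Submodule.topEquiv.symm.toLinearMap ∘ₗ g, by
        simpa [map_eq_zero_iff _ hg] using hx⟩
  have := hU.1
  have := hU.2
  have : Module.Projective R (LinearMap.range h) :=
    projective_of_injective hR (LinearMap.range h).subtype (Submodule.subtype_injective _)
  have hhi : Function.Injective h := hP.injective_of_projective_range h
    fun h0 => hh (by rw [h0, LinearMap.zero_apply])
  intro V W
  rcases eq_or_ne (V ⊔ W) ⊥ with h0 | h0
  · exact Or.inl ((le_sup_left.trans h0.le).trans bot_le)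
  have hVWi : Function.Injective (h ∘ₗ (V ⊔ W).subtype) := hhi.comp (Submodule.subtype_injective _)
  have hVW : IsIndecomposableModule R ↥(V ⊔ W) := by
    refine ⟨Submodule.nontrivial_iff_ne_bot.2 h0, fun X Y hXY => ?_⟩
    have hd : Disjoint (X.map (h ∘ₗ (V ⊔ W).subtype)) (Y.map (h ∘ₗ (V ⊔ W).subtype)) := by
      rw [disjoint_iff, ← Submodule.map_inf _ hVWi, hXY.inf_eq_bot, Submodule.map_bot]
    exact (hUi.eq_bot_or_eq_bot_of_disjoint hd).imp
      (fun h1 => Submodule.map_injective_of_injective hVWi (by rw [h1, Submodule.map_bot]))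
      (fun h1 => Submodule.map_injective_of_injective hVWi (by rw [h1, Submodule.map_bot]))
  have : Module.Projective R ↥(V ⊔ W) :=
    projective_of_injective hR (V ⊔ W).subtype (Submodule.subtype_injective _)
  have hco : Codisjoint (V.submoduleOf (V ⊔ W)) (W.submoduleOf (V ⊔ W)) := by
    rw [codisjoint_iff]
    rw [← Submodule.submoduleOf_sup_of_le le_sup_left le_sup_right, Submodule.submoduleOf_self]
  rcases hVW.eq_top_or_eq_top_of_codisjoint hco with h1 | h1
  · exact Or.inr (le_sup_right.trans (Submodule.submoduleOf_eq_top.1 h1))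
  · exact Or.inl (le_sup_left.trans (Submodule.submoduleOf_eq_top.1 h1))

/-- A free cover of `I` extends over a projective-injective module containing the free module. An
indecomposable summand already maps onto `I`, and it is uniserial by the projective case. -/
theorem isUniserialModule_of_injective_of_closed [IsNoetherianRing R] [IsArtinianRing R]
    (hR : ∀ I : Submodule R R, Module.Projective R I)
    (hQ : ∀ (P : Type u) [AddCommGroup P] [Module R P], Module.Finite R P →
      Module.Projective R P → ∃ (Q : Type u) (_ : AddCommGroup Q) (_ : Module R Q),
        Module.Finite R Q ∧ Module.Projective R Q ∧ Module.Injective R Q ∧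
          ∃ g : P →ₗ[R] Q, Function.Injective g)
    (I : Type u) [AddCommGroup I] [Module R I] [Module.Finite R I] [Module.Injective R I]
    (hI : IsIndecomposableModule R I) : IsUniserialModule R I := by
  have := hI.1
  obtain ⟨n, φ, hφ⟩ := Module.Finite.exists_fin' R I
  obtain ⟨Q, _, _, hQf, hQp, hQi, i, hi⟩ := hQ (Fin n → R) inferInstance inferInstance
  obtain ⟨g, hg⟩ := Module.Injective.out i hi φ
  have hgs : Function.Surjective g := fun y => by
    obtain ⟨x, rfl⟩ := hφ y
    exact ⟨i x, hg x⟩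
  obtain ⟨U, ⟨hU, hUI⟩, hUi⟩ := exists_isIndecomposableModule
    (fun U : Submodule R Q => (Module.Projective R U ∧ Module.Injective R U) ∧ U.map g = ⊤)
    (fun h => by simpa using h.2) (fun U hU X Y h => by
      have hX := projective_and_injective_map_subtype h hU.1
      have hY := projective_and_injective_map_subtype h.symm hU.1
      have := hX.2
      -- The image of a summand is a quotient of an injective module, hence injective, hence a
      -- direct summand of the indecomposable `I`: it is zero or everything.
      have : Module.Injective R ↥((X.map U.subtype).map g) :=
        injective_of_surjective hR (g.submoduleMap (X.map U.subtype))
          (LinearMap.submoduleMap_surjective _ _)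
      obtain ⟨r, hr⟩ := exists_retraction_of_injective ((X.map U.subtype).map g).subtype
        (Submodule.subtype_injective _)
      have hc := isCompl_ker_range_of_comp_eq_id hr
      rw [Submodule.range_subtype] at hc
      rcases hI.2 _ _ hc with h1 | h1
      · refine Or.inl ⟨hX, ?_⟩
        rw [h1] at hc
        exact eq_top_of_bot_isCompl hc
      · refine Or.inr ⟨hY, ?_⟩
        rw [← hU.2, ← map_sup_map_of_isCompl g h, h1, bot_sup_eq]) ⊤
    ⟨projective_and_injective_top Q, by rw [Submodule.map_top, LinearMap.range_eq_top.2 hgs]⟩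
  have := hU.1
  refine (isUniserialModule_of_projective_of_closed hR hQ U hUi).of_surjective (g ∘ₗ U.subtype) ?_
  rw [← LinearMap.range_eq_top, LinearMap.range_comp, Submodule.range_subtype, hUI]

end Uniserial

/-! ### The center of a hereditary artin algebra and the module `DA` -/

section Dual

variable {A : Type u} [Ring A]

/-- For central `c` with `c² = 0`, a section `s` of right multiplication `A → Ac` satisfies `s(c) c
= c` and `c s(c) = s(c²) = 0`; centrality gives `c = 0`. -/
theorem isReduced_center (hR : ∀ I : Submodule A A, Module.Projective A I) :
    IsReduced (Subring.center A) := by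
  refine (isReduced_iff_pow_one_lt 2 one_lt_two).2 fun c hc => ?_
  have hcc : (c : A) * c = 0 := by
    have := congrArg (Subring.subtype _) hc
    simpa [pow_two] using this
  let f : A →ₗ[A] A := LinearMap.toSpanSingleton A A c
  have := hR (LinearMap.range f)
  obtain ⟨s, hs⟩ := Module.projective_lifting_property f.rangeRestrict LinearMap.id
    f.surjective_rangeRestrict
  have hmem : (c : A) ∈ LinearMap.range f := ⟨1, by simp [f]⟩
  have h1 : s ⟨c, hmem⟩ * c = c := congrArg Subtype.val (LinearMap.congr_fun hs ⟨c, hmem⟩)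
  have h2 : (c : A) * s ⟨c, hmem⟩ = 0 := by
    rw [← smul_eq_mul, ← map_smul]
    have : (c : A) • (⟨c, hmem⟩ : LinearMap.range f) = 0 := Subtype.ext hcc
    rw [this, map_zero]
  refine Subtype.ext ?_
  rw [← h1, Subring.mem_center_iff.1 c.2, h2]
  rfl

theorem isSemisimpleRing_center (hA : IsArtinAlgebra A)
    (hR : ∀ I : Submodule A A, Module.Projective A I) : IsSemisimpleRing (Subring.center A) :=
  have := hA.isArtinianRing_center
  have := isReduced_center hR
  IsArtinianRing.isSemisimpleRing_of_isReduced _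

theorem IsArtinAlgebra.isNoetherianRing (hA : IsArtinAlgebra A) : IsNoetherianRing A :=
  have := hA.isArtinianRing_center
  have := hA.finite_center
  isNoetherian_of_tower (Subring.center A) inferInstance

theorem IsArtinAlgebra.isArtinianRing (hA : IsArtinAlgebra A) : IsArtinianRing A :=
  have := hA.isArtinianRing_center
  have := hA.finite_center
  isArtinian_of_tower (Subring.center A) inferInstance

theorem IsArtinAlgebra.isNoetherianRing_mulOpposite (hA : IsArtinAlgebra A) :
    IsNoetherianRing Aᵐᵒᵖ :=
  have := hA.isArtinianRing_center
  have := hA.finite_center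
  have : Module.Finite (Subring.center A) Aᵐᵒᵖ :=
    Module.Finite.equiv (MulOpposite.opLinearEquiv (Subring.center A))
  isNoetherian_of_tower (Subring.center A) inferInstance

instance : Module (Subring.center A) (DualRegular A) :=
  inferInstanceAs (Module (Subring.center A) (A →ₗ[Subring.center A] Subring.center A))

namespace DualRegular

theorem ext {f g : DualRegular A} (h : ∀ x, f.toLin x = g.toLin x) : f = g := LinearMap.ext h

@[simp] theorem smul_apply (a : A) (f : DualRegular A) (x : A) :
    (a • f).toLin x = f.toLin (x * a) := rfl

@[simp] theorem center_smul_apply (c : Subring.center A) (f : DualRegular A) (x : A) :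
    (c • f).toLin x = c * f.toLin x := rfl

@[simp] theorem add_apply (f g : DualRegular A) (x : A) :
    (f + g).toLin x = f.toLin x + g.toLin x := rfl

@[simp] theorem zero_apply (x : A) : (0 : DualRegular A).toLin x = 0 := rfl

@[simp] theorem dualRegularMul_apply (a : A) (f : DualRegular A) (x : A) :
    (dualRegularMul A a f).toLin x = f.toLin (a * x) := rfl

theorem center_smul_eq (c : Subring.center A) (f : DualRegular A) : c • f = (c : A) • f := by
  refine ext fun x => ?_
  rw [center_smul_apply, smul_apply, Subring.mem_center_iff.1 c.2 x]
  exact (map_smul f.toLin c x).symm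

instance : IsScalarTower (Subring.center A) A (DualRegular A) where
  smul_assoc c a f := by
    rw [center_smul_eq, ← mul_smul]
    rfl

theorem eq_of_forall_apply_eq [IsSemisimpleRing (Subring.center A)] {a b : A}
    (h : ∀ f : DualRegular A, f.toLin a = f.toLin b) : a = b := by
  have := Module.projective_of_isSemisimpleRing (Subring.center A) A
  rw [← sub_eq_zero, ← Module.forall_dual_apply_eq_zero_iff (Subring.center A)]
  intro φ
  rw [map_sub, sub_eq_zero]
  exact h φ

theorem exists_eq_apply [IsSemisimpleRing (Subring.center A)] [Module.Finite (Subring.center A) A]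
    (φ : DualRegular A →ₗ[Subring.center A] Subring.center A) :
    ∃ a : A, ∀ f : DualRegular A, φ f = f.toLin a := by
  have := Module.projective_of_isSemisimpleRing (Subring.center A) A
  obtain ⟨a, ha⟩ := (Module.evalEquiv (Subring.center A) A).surjective φ
  exact ⟨a, fun f => (LinearMap.congr_fun ha f).symm⟩

theorem bijective_toRightEndDual [IsSemisimpleRing (Subring.center A)]
    [Module.Finite (Subring.center A) A] : Function.Bijective (toRightEndDual A) := by
  refine ⟨fun a b hab => eq_of_forall_apply_eq fun f => ?_, fun b => ?_⟩
  · have h : dualRegularMul A a = dualRegularMul A b := MulOpposite.op_injective hab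
    have := congrArg (fun g => toLin g 1) (LinearMap.congr_fun h f)
    simpa using this
  · let φ : DualRegular A →ₗ[Subring.center A] Subring.center A :=
      { toFun := fun f => (b.unop f).toLin 1
        map_add' := fun f g => by simp
        map_smul' := fun c f => by
          rw [center_smul_eq, map_smul, ← center_smul_eq]
          rfl }
    obtain ⟨a, ha⟩ := exists_eq_apply φ
    refine ⟨a, MulOpposite.unop_injective (LinearMap.ext fun f => ext fun x => ?_)⟩
    have := ha (x • f)
    change (b.unop (x • f)).toLin 1 = (x • f).toLin a at this
    rw [map_smul, smul_apply, one_mul, smul_apply] at this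
    exact this.symm

instance [IsSemisimpleRing (Subring.center A)] [Module.Finite (Subring.center A) A] :
    Module.Finite A (DualRegular A) :=
  have : Module.Finite (Subring.center A) (DualRegular A) :=
    inferInstanceAs (Module.Finite (Subring.center A) (Module.Dual (Subring.center A) A))
  Module.Finite.of_restrictScalars_finite (Subring.center A) A _

/-- The linear map into `DA` that corresponds to a linear form over the center. -/
def lift {M : Type u} [AddCommGroup M] [Module A M] [Module (Subring.center A) M]
    [IsScalarTower (Subring.center A) A M] (φ : M →ₗ[Subring.center A] Subring.center A) :
    M →ₗ[A] DualRegular A where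
  toFun m := φ ∘ₗ (LinearMap.toSpanSingleton A M m).restrictScalars (Subring.center A)
  map_add' m n := ext fun x => (congrArg φ (smul_add x m n)).trans (map_add φ _ _)
  map_smul' a m := ext fun x => congrArg φ (mul_smul x a m).symm

@[simp] theorem lift_apply {M : Type u} [AddCommGroup M] [Module A M]
    [Module (Subring.center A) M] [IsScalarTower (Subring.center A) A M]
    (φ : M →ₗ[Subring.center A] Subring.center A) (m : M) (x : A) :
    (lift φ m).toLin x = φ (x • m) := rfl

/-- Maps into `DA` amount to `k`-linear forms through evaluation at `1`, and such forms extend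
because `k` is semisimple. -/
instance [IsSemisimpleRing (Subring.center A)] : Module.Injective A (DualRegular A) where
  out X Y _ _ _ _ i hi g := by
    let _ : Module (Subring.center A) X := Module.compHom X (Subring.center A).subtype
    let _ : Module (Subring.center A) Y := Module.compHom Y (Subring.center A).subtype
    have : IsScalarTower (Subring.center A) A X := ⟨fun c a x => mul_smul (c : A) a x⟩
    have : IsScalarTower (Subring.center A) A Y := ⟨fun c a x => mul_smul (c : A) a x⟩
    let φ : X →ₗ[Subring.center A] Subring.center A :=
      { toFun := fun x => (g x).toLin 1
        map_add' := fun x y => by simp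
        map_smul' := fun c x => by
          rw [← algebraMap_smul A c x, map_smul, algebraMap_smul]
          rfl }
    obtain ⟨s, hs⟩ := IsSemisimpleModule.extension_property
      (i.restrictScalars (Subring.center A)) hi LinearMap.id
    refine ⟨lift (φ ∘ₗ s), fun x => ext fun a => ?_⟩
    have := LinearMap.congr_fun hs (a • x)
    simp only [LinearMap.comp_apply, LinearMap.restrictScalars_apply, LinearMap.id_apply,
      map_smul] at this
    rw [lift_apply, LinearMap.comp_apply, this]
    change (g (a • x)).toLin 1 = _
    rw [map_smul, smul_apply, one_mul]

/-- Finitely many forms generate the `k`-dual of `M` and therefore separate points; each of them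
lifts to a map into `DA`. -/
theorem exists_injective_pi [IsSemisimpleRing (Subring.center A)]
    [Module.Finite (Subring.center A) A] (M : Type u) [AddCommGroup M] [Module A M]
    [Module.Finite A M] :
    ∃ (n : ℕ) (g : M →ₗ[A] (Fin n → DualRegular A)), Function.Injective g := by
  let _ : Module (Subring.center A) M := Module.compHom M (Subring.center A).subtype
  have : IsScalarTower (Subring.center A) A M := ⟨fun c a x => mul_smul (c : A) a x⟩
  have : Module.Finite (Subring.center A) M := Module.Finite.trans A M
  have := Module.projective_of_isSemisimpleRing (Subring.center A) M
  obtain ⟨n, p, hp⟩ := Module.Finite.exists_fin' (Subring.center A)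
    (Module.Dual (Subring.center A) M)
  refine ⟨n, LinearMap.pi fun i => lift (p (Pi.single i 1)), ?_⟩
  rw [injective_iff_map_eq_zero]
  intro m hm
  rw [← Module.forall_dual_apply_eq_zero_iff (Subring.center A)]
  intro φ
  obtain ⟨v, rfl⟩ := hp φ
  have h0 (i : Fin n) : p (Pi.single i 1) m = 0 := by
    have := congrArg (fun f => toLin f 1) (congrFun hm i)
    simpa using this
  rw [pi_eq_sum_univ' v, map_sum, LinearMap.sum_apply]
  refine Finset.sum_eq_zero fun i _ => ?_
  rw [map_smul, LinearMap.smul_apply]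
  rw [h0, smul_zero]

/-- A tensor product `DA ⊗ N` vanishes if and only if `N` has no nonzero linear forms. -/
theorem subsingleton_tensorRightEnd_iff [IsSemisimpleRing (Subring.center A)]
    [Module.Finite (Subring.center A) A] (N : Type u) [AddCommGroup N]
    [Module (RightEnd A (DualRegular A)) N] :
    Subsingleton (TensorRightEnd A (DualRegular A) N) ↔
      ∀ h : N →+ A, (∀ (a : A) (n : N), h (toRightEndDual A a • n) = a * h n) → h = 0 := by
  constructor
  · intro hs h hh
    -- The pairing `f ⊗ n ↦ f(h n)` respects the defining relations, so it vanishes when the tensor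
    -- product does.
    let Φ : DualRegular A ⊗[ℤ] N →+ Subring.center A :=
      TensorProduct.liftAddHom
        { toFun := fun f => f.toLin.toAddMonoidHom.comp h
          map_zero' := rfl
          map_add' := fun f g => rfl } fun r f n => by
          simp
    have hΦ (f : DualRegular A) (n : N) : Φ (f ⊗ₜ n) = f.toLin (h n) := rfl
    have hle : AddSubgroup.closure {z : DualRegular A ⊗[ℤ] N | ∃ (t : DualRegular A)
        (b : RightEnd A (DualRegular A)) (n : N),
          z = (b.unop t) ⊗ₜ[ℤ] n - t ⊗ₜ[ℤ] (b • n)} ≤ Φ.ker := by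
      rw [AddSubgroup.closure_le]
      rintro _ ⟨t, b, n, rfl⟩
      obtain ⟨a, rfl⟩ := bijective_toRightEndDual.2 b
      change Φ _ = 0
      rw [map_sub, hΦ, hΦ, hh, sub_eq_zero]
      rfl
    refine AddMonoidHom.ext fun n => eq_of_forall_apply_eq fun f => ?_
    have hmem := (QuotientAddGroup.eq_zero_iff (f ⊗ₜ[ℤ] n)).1 (Subsingleton.elim
      (QuotientAddGroup.mk (f ⊗ₜ[ℤ] n) : TensorRightEnd A (DualRegular A) N) 0)
    have := hle hmem
    change Φ _ = 0 at this
    rw [hΦ] at this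
    rw [this]
    exact (map_zero f.toLin).symm
  · intro H
    let C := AddSubgroup.closure {z : DualRegular A ⊗[ℤ] N | ∃ (t : DualRegular A)
        (b : RightEnd A (DualRegular A)) (n : N),
          z = (b.unop t) ⊗ₜ[ℤ] n - t ⊗ₜ[ℤ] (b • n)}
    -- The relations are stable under `k`, so the vanishing of the quotient can be tested by
    -- `k`-linear forms.
    let K : Submodule (Subring.center A) (DualRegular A ⊗[ℤ] N) :=
      { C with
        smul_mem' := fun c z hz => by
          change z ∈ C at hz
          change c • z ∈ C
          induction hz using AddSubgroup.closure_induction with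
          | mem z hz =>
            obtain ⟨t, b, n, rfl⟩ := hz
            refine AddSubgroup.subset_closure ⟨c • t, b, n, ?_⟩
            rw [smul_sub, TensorProduct.smul_tmul', TensorProduct.smul_tmul', center_smul_eq,
              center_smul_eq, map_smul]
          | zero =>
            rw [smul_zero]
            exact zero_mem _
          | add x y _ _ hx hy =>
            rw [smul_add]
            exact add_mem hx hy
          | neg x _ hx =>
            rw [smul_neg]
            exact neg_mem hx }
    have := Module.projective_of_isSemisimpleRing (Subring.center A) (DualRegular A ⊗[ℤ] N ⧸ K)
    have hK : ∀ z, z ∈ K := by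
      intro z
      rw [← Submodule.Quotient.mk_eq_zero, ← Module.forall_dual_apply_eq_zero_iff
        (Subring.center A)]
      intro φ
      -- For fixed `n`, the form `f ↦ φ(f ⊗ n)` is evaluation at an element `h n` of `A`. The
      -- relations make `h` linear, so `H` applies.
      let ψ (n : N) : DualRegular A →ₗ[Subring.center A] Subring.center A :=
        { toFun := fun f => φ (K.mkQ (f ⊗ₜ n))
          map_add' := fun f g => by rw [TensorProduct.add_tmul, map_add, map_add]
          map_smul' := fun c f => by
            rw [← TensorProduct.smul_tmul', map_smul, map_smul]
            rfl }
      choose h hh using fun n => exists_eq_apply (ψ n)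
      have hψ (n : N) (f : DualRegular A) : φ (K.mkQ (f ⊗ₜ n)) = f.toLin (h n) := hh n f
      let h' : N →+ A := AddMonoidHom.mk' h fun m n => eq_of_forall_apply_eq fun f => by
        rw [map_add, ← hψ, ← hψ, ← hψ, TensorProduct.tmul_add, map_add, map_add]
      have h0 : h' = 0 := H h' fun a n => eq_of_forall_apply_eq fun f => by
        change f.toLin (h _) = f.toLin (a * h n)
        have h1 := hψ n (dualRegularMul A a f)
        rw [dualRegularMul_apply] at h1
        rw [← h1, ← hψ, ← sub_eq_zero, ← map_sub, ← map_sub]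
        have : f ⊗ₜ[ℤ] (toRightEndDual A a • n) - dualRegularMul A a f ⊗ₜ[ℤ] n ∈ K := by
          rw [← neg_sub]
          exact K.neg_mem (AddSubgroup.subset_closure ⟨f, toRightEndDual A a, n, rfl⟩)
        rw [Submodule.mkQ_apply, (Submodule.Quotient.mk_eq_zero K).2 this, map_zero]
      induction z using TensorProduct.induction_on with
      | zero => simp
      | tmul f n =>
        refine (hψ n f).trans ?_
        have : h n = 0 := DFunLike.congr_fun h0 n
        rw [this, map_zero]
      | add x y hx hy => rw [Submodule.Quotient.mk_add, map_add, hx, hy, add_zero]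
    refine ⟨fun x y => ?_⟩
    obtain ⟨x, rfl⟩ := QuotientAddGroup.mk_surjective x
    obtain ⟨y, rfl⟩ := QuotientAddGroup.mk_surjective y
    exact QuotientAddGroup.eq.2 (hK _)

end DualRegular

end Dual

/-! ### Linear forms and the classes `𝒳(DA)` and `𝒲(A)` -/

section Classes

variable {A : Type u} [Ring A]

theorem isFiniteLength_iff_of_ringEquiv {R S : Type u} [Ring R] [Ring S] (e : R ≃+* S)
    {M N : Type u} [AddCommGroup M] [Module R M] [AddCommGroup N] [Module S N] (f : M ≃+ N)
    (hf : ∀ (r : R) (m : M), f (r • m) = e r • f m) :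
    IsFiniteLength R M ↔ IsFiniteLength S N := by
  let _ : RingHomInvPair (e : R →+* S) (e.symm : S →+* R) := RingHomInvPair.of_ringEquiv e
  let _ : RingHomInvPair (e.symm : S →+* R) (e : R →+* S) := RingHomInvPair.of_ringEquiv e.symm
  let g : M ≃ₛₗ[(e : R →+* S)] N := { f with map_smul' := hf }
  let o := Submodule.orderIsoMapComap g
  rw [isFiniteLength_iff_isNoetherian_isArtinian, isFiniteLength_iff_isNoetherian_isArtinian,
    isNoetherian_iff', isNoetherian_iff']
  refine and_congr ⟨fun _ => ?_, fun _ => ?_⟩ ⟨fun _ => ?_, fun _ => ?_⟩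
  · exact o.symm.toOrderEmbedding.wellFoundedGT
  · exact o.toOrderEmbedding.wellFoundedGT
  · exact o.symm.toOrderEmbedding.wellFoundedLT
  · exact o.toOrderEmbedding.wellFoundedLT

theorem classXDual_iff [IsSemisimpleRing (Subring.center A)] [Module.Finite (Subring.center A) A]
    (M : ModuleCat.{u} A) :
    classXDual A M ↔ IsFiniteLength A M ∧ ∀ f : M →ₗ[A] A, f = 0 := by
  let e : A ≃+* RightEnd A (DualRegular A) :=
    RingEquiv.ofBijective (toRightEndDual A) DualRegular.bijective_toRightEndDual
  constructor
  · rintro ⟨N, ⟨hN, hs⟩, ⟨i⟩⟩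
    let f : M ≃+ N := i.symm.toLinearEquiv.toAddEquiv
    have hf (a : A) (m : M) : f (a • m) = toRightEndDual A a • f m :=
      i.symm.toLinearEquiv.map_smul a m
    refine ⟨(isFiniteLength_iff_of_ringEquiv e f hf).2 hN, fun h => ?_⟩
    have h0 := (DualRegular.subsingleton_tensorRightEnd_iff N).1 hs
      (h.toAddMonoidHom.comp f.symm.toAddMonoidHom) fun a n => by
        obtain ⟨m, rfl⟩ := f.surjective n
        change h (f.symm (toRightEndDual A a • f m)) = a * h (f.symm (f m))
        rw [← hf, f.symm_apply_apply, f.symm_apply_apply, map_smul, smul_eq_mul]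
    refine LinearMap.ext fun m => ?_
    have : h (f.symm (f m)) = 0 := DFunLike.congr_fun h0 (f m)
    rwa [f.symm_apply_apply] at this
  · rintro ⟨hM, h⟩
    let N : ModuleCat.{u} (RightEnd A (DualRegular A)) :=
      (ModuleCat.restrictScalars.{u} (e.symm : RightEnd A (DualRegular A) →+* A)).obj M
    let f : M ≃+ N := AddEquiv.refl M
    have hf (a : A) (m : M) : f (a • m) = e a • f m := by
      change a • m = e.symm (e a) • m
      rw [e.symm_apply_apply]
    let N' : ModuleCat.{u} A := (ModuleCat.restrictScalars.{u} (toRightEndDual A)).obj N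
    let i : N' ≃ₗ[A] M := { f.symm with map_smul' := fun a m => (hf a m).symm }
    refine ⟨N, ⟨(isFiniteLength_iff_of_ringEquiv e f hf).1 hM,
      (DualRegular.subsingleton_tensorRightEnd_iff N).2 fun g hg => ?_⟩, ⟨i.toModuleIso⟩⟩
    have := h { g.comp f.toAddMonoidHom with
      map_smul' := fun a m => by
        change g (f (a • m)) = a * g (f m)
        rw [hf]
        exact hg a (f m) }
    refine AddMonoidHom.ext fun n => ?_
    exact LinearMap.congr_fun this n

theorem classNoProjectiveSummand_iff [IsNoetherianRing A] [IsArtinianRing A]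
    (hR : ∀ I : Submodule A A, Module.Projective A I) (M : ModuleCat.{u} A) :
    classNoProjectiveSummand A M ↔ IsFiniteLength A M ∧ ∀ f : M →ₗ[A] A, f = 0 := by
  refine and_congr_right fun hM => ⟨fun h f => ?_, fun h U V hUV ⟨hU, hP⟩ => ?_⟩
  · by_contra hf
    obtain ⟨U, hU, j, p, hpj⟩ := exists_retract_of_linearMap_ne_zero hR f hf
    let e := LinearEquiv.ofInjective j (LinearMap.injective_of_comp_eq_id j p hpj)
    have := hR U
    exact h _ _ (isCompl_ker_range_of_comp_eq_id hpj).symm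
      ⟨isIndecomposableModule_congr e hU, Module.Projective.of_equiv e⟩
  · have := (isFiniteLength_iff_isNoetherian_isArtinian.1 hM).1
    have := hU.1
    obtain ⟨x, hx⟩ := exists_ne (0 : U)
    obtain ⟨f, hf⟩ := exists_linearMap_apply_ne_zero (R := A) U hx
    apply hf
    have := LinearMap.congr_fun (h (f ∘ₗ U.projectionOnto V hUV)) x
    simpa using this

open Abelian

theorem ofHom_smul (N : ModuleCat.{u} Aᵐᵒᵖ) (a : A) (φ : N →ₗ[Aᵐᵒᵖ] A) :
    (ModuleCat.ofHom (a • φ) : N ⟶ ModuleCat.of Aᵐᵒᵖ A) =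
      ModuleCat.ofHom φ ≫ rightRegularMul A a := rfl

/-- The connecting map from the linear forms on the first term of a short exact sequence to the
extensions of the last term by the regular module. -/
noncomputable def extConnecting {S : ShortComplex (ModuleCat.{u} Aᵐᵒᵖ)} (hS : S.ShortExact) :
    (S.X₁ →ₗ[Aᵐᵒᵖ] A) →ₗ[A] ExtOneRegular A S.X₃ where
  toFun φ := hS.extClass.comp
    (Ext.mk₀ (ModuleCat.ofHom φ : S.X₁ ⟶ ModuleCat.of Aᵐᵒᵖ A)) (add_zero 1)
  map_add' φ ψ := by
    rw [ModuleCat.ofHom_add, Ext.mk₀_add, Ext.comp_add]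
    rfl
  map_smul' a φ := by
    rw [ofHom_smul, ← Ext.mk₀_comp_mk₀]
    exact (Ext.comp_assoc_of_third_deg_zero _ _ _ (add_zero 1)).symm

/-- The next term of the long exact sequence is `Ext¹` of the projective middle term, which is zero.
-/
theorem extConnecting_surjective {S : ShortComplex (ModuleCat.{u} Aᵐᵒᵖ)} (hS : S.ShortExact)
    [Module.Projective Aᵐᵒᵖ S.X₂] : Function.Surjective (extConnecting hS) := by
  intro (x : Ext S.X₃ (ModuleCat.of Aᵐᵒᵖ A) 1)
  have : Projective S.X₂ := (IsProjective.iff_projective _).1 inferInstance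
  obtain ⟨y, hy⟩ := Ext.contravariant_sequence_exact₃ hS _ x (Ext.eq_zero_of_projective _)
    (add_zero 1)
  obtain ⟨φ, rfl⟩ := Ext.addEquiv₀.symm.surjective y
  exact ⟨φ.hom, hy⟩

theorem extConnecting_eq_zero_iff {S : ShortComplex (ModuleCat.{u} Aᵐᵒᵖ)} (hS : S.ShortExact)
    (φ : S.X₁ →ₗ[Aᵐᵒᵖ] A) :
    extConnecting hS φ = 0 ↔ ∃ ψ : S.X₂ →ₗ[Aᵐᵒᵖ] A, φ = ψ ∘ₗ S.f.hom := by
  constructor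
  · intro h
    obtain ⟨y, hy⟩ := Ext.contravariant_sequence_exact₁ hS (ModuleCat.of Aᵐᵒᵖ A)
      (Ext.mk₀ (ModuleCat.ofHom φ)) (add_zero 1) h
    obtain ⟨ψ, rfl⟩ := Ext.addEquiv₀.symm.surjective y
    refine ⟨ψ.hom, ?_⟩
    rw [Ext.addEquiv₀_symm_apply, Ext.mk₀_comp_mk₀] at hy
    have := Ext.addEquiv₀.symm.injective hy
    exact (congrArg ModuleCat.Hom.hom this).symm
  · rintro ⟨ψ, rfl⟩
    have h : (ModuleCat.ofHom (ψ ∘ₗ S.f.hom) : S.X₁ ⟶ ModuleCat.of Aᵐᵒᵖ A) =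
      S.f ≫ ModuleCat.ofHom ψ := rfl
    change hS.extClass.comp (Ext.mk₀ _) (add_zero 1) = 0
    rw [h, ← Ext.mk₀_comp_mk₀, hS.extClass_comp_assoc]

/-- A short exact sequence of modules from an injective and a surjective linear map. -/
theorem shortExact_of_linearMap {R : Type u} [Ring R] {X₁ X₂ X₃ : Type u} [AddCommGroup X₁]
    [Module R X₁] [AddCommGroup X₂] [Module R X₂] [AddCommGroup X₃] [Module R X₃]
    (f : X₁ →ₗ[R] X₂) (g : X₂ →ₗ[R] X₃) (hf : Function.Injective f) (hg : Function.Surjective g)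
    (h : LinearMap.range f = LinearMap.ker g) :
    (ShortComplex.mk (ModuleCat.ofHom f) (ModuleCat.ofHom g) (by
      rw [← ModuleCat.ofHom_comp, LinearMap.range_le_ker_iff.1 h.le]; rfl)).ShortExact where
  exact := by
    rw [ShortComplex.moduleCat_exact_iff_range_eq_ker]
    exact h
  mono_f := (ModuleCat.mono_iff_injective _).2 hf
  epi_g := (ModuleCat.epi_iff_surjective _).2 hg

/-- The right regular module is the left regular module of the opposite ring. -/
def mulOppositeRegularEquiv (A : Type u) [Ring A] : Aᵐᵒᵖ ≃ₗ[Aᵐᵒᵖ] A where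
  toFun a := a.unop
  invFun := MulOpposite.op
  map_add' _ _ := rfl
  map_smul' _ _ := rfl

theorem projective_mulOpposite
    (hR : ∀ I : Submodule Aᵐᵒᵖ A, Module.Projective Aᵐᵒᵖ I) (I : Submodule Aᵐᵒᵖ Aᵐᵒᵖ) :
    Module.Projective Aᵐᵒᵖ I :=
  have := hR (I.map (mulOppositeRegularEquiv A).toLinearMap)
  Module.Projective.of_equiv (I.equivMapOfInjective (mulOppositeRegularEquiv A).toLinearMap
    (mulOppositeRegularEquiv A).injective).symm

end Classes

/-! ### Duality for finite projective modules -/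

section DualBasis

variable {A : Type u} [Ring A]

theorem exists_dualBasis {R : Type u} [Ring R] (P : Type u) [AddCommGroup P] [Module R P]
    [Module.Finite R P] [Module.Projective R P] :
    ∃ (n : ℕ) (q : Fin n → P) (f : Fin n → P →ₗ[R] R), ∀ x, ∑ i, f i x • q i = x := by
  obtain ⟨n, i, p, hip⟩ := exists_split_of_finite_projective (R := R) P
  refine ⟨n, fun k => p (Pi.single k 1), fun k => LinearMap.proj k ∘ₗ i, fun x => ?_⟩
  have := LinearMap.congr_fun hip x
  rw [LinearMap.comp_apply, pi_eq_sum_univ' (i x), map_sum] at this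
  refine Eq.trans (Finset.sum_congr rfl fun k _ => ?_) this
  rw [map_smul]
  rfl

theorem exists_dualBasis_mulOpposite (P : Type u) [AddCommGroup P] [Module Aᵐᵒᵖ P]
    [Module.Finite Aᵐᵒᵖ P] [Module.Projective Aᵐᵒᵖ P] :
    ∃ (n : ℕ) (q : Fin n → P) (f : Fin n → P →ₗ[Aᵐᵒᵖ] A),
      ∀ x, ∑ i, MulOpposite.op (f i x) • q i = x := by
  obtain ⟨n, q, f, h⟩ := exists_dualBasis (R := Aᵐᵒᵖ) P
  exact ⟨n, q, fun i => (mulOppositeRegularEquiv A).toLinearMap ∘ₗ f i, h⟩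

theorem finite_dual_mulOpposite (P : Type u) [AddCommGroup P] [Module Aᵐᵒᵖ P]
    [Module.Finite Aᵐᵒᵖ P] [Module.Projective Aᵐᵒᵖ P] :
    Module.Finite A (P →ₗ[Aᵐᵒᵖ] A) := by
  obtain ⟨n, q, f, h⟩ := exists_dualBasis_mulOpposite (A := A) P
  refine Module.Finite.of_surjective (Fintype.linearCombination A f) fun φ =>
    ⟨fun i => φ (q i), LinearMap.ext fun x => ?_⟩
  conv_rhs => rw [← h x]
  simp [Fintype.linearCombination_apply]

/-- A dual basis gives `φ = ∑ φ(q i) • f i`, so `g` is evaluation at the combination of the `q i`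
with coefficients `g (f i)`. -/
theorem exists_eq_eval_mulOpposite (P : Type u) [AddCommGroup P] [Module Aᵐᵒᵖ P]
    [Module.Finite Aᵐᵒᵖ P] [Module.Projective Aᵐᵒᵖ P] (g : (P →ₗ[Aᵐᵒᵖ] A) →ₗ[A] A) :
    ∃ p : P, ∀ φ, g φ = φ p := by
  obtain ⟨n, q, f, h⟩ := exists_dualBasis_mulOpposite (A := A) P
  refine ⟨∑ i, MulOpposite.op (g (f i)) • q i, fun φ => ?_⟩
  have hφ : φ = ∑ i, φ (q i) • f i := LinearMap.ext fun x => by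
    conv_lhs => rw [← h x]
    simp
  conv_lhs => rw [hφ]
  simp

theorem exists_eq_eval (P : Type u) [AddCommGroup P] [Module A P]
    [Module.Finite A P] [Module.Projective A P] (g : (P →ₗ[A] A) →ₗ[Aᵐᵒᵖ] A) :
    ∃ p : P, ∀ φ, g φ = φ p := by
  obtain ⟨n, q, f, h⟩ := exists_dualBasis (R := A) P
  refine ⟨∑ i, g (f i) • q i, fun φ => ?_⟩
  have hφ : φ = ∑ i, MulOpposite.op (φ (q i)) • f i := LinearMap.ext fun x => by
    conv_lhs => rw [← h x]
    simp
  conv_lhs => rw [hφ]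
  simp

theorem finite_projective_dual (P : Type u) [AddCommGroup P] [Module A P]
    [Module.Finite A P] [Module.Projective A P] :
    Module.Finite Aᵐᵒᵖ (P →ₗ[A] A) ∧ Module.Projective Aᵐᵒᵖ (P →ₗ[A] A) := by
  obtain ⟨n, q, f, h⟩ := exists_dualBasis (R := A) P
  let i : (P →ₗ[A] A) →ₗ[Aᵐᵒᵖ] (Fin n → Aᵐᵒᵖ) :=
    { toFun := fun φ k => MulOpposite.op (φ (q k))
      map_add' := fun φ ψ => rfl
      map_smul' := fun a φ => rfl }
  have hi : Fintype.linearCombination Aᵐᵒᵖ f ∘ₗ i = LinearMap.id := by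
    refine LinearMap.ext fun φ => LinearMap.ext fun x => ?_
    conv_rhs => rw [← h x]
    simp [Fintype.linearCombination_apply, i]
  exact ⟨Module.Finite.of_surjective _ (LinearMap.surjective_of_comp_eq_id i _ hi),
    Module.Projective.of_split i _ hi⟩

/-- The evaluation map into the double dual. -/
def doubleDualEval (P : Type u) [AddCommGroup P] [Module A P] :
    P →ₗ[A] (P →ₗ[A] A) →ₗ[Aᵐᵒᵖ] A where
  toFun p :=
    { toFun := fun φ => φ p
      map_add' := fun _ _ => rfl
      map_smul' := fun _ _ => rfl }
  map_add' p q := LinearMap.ext fun φ => map_add φ p q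
  map_smul' a p := LinearMap.ext fun φ => map_smul φ a p

theorem doubleDualEval_bijective (P : Type u) [AddCommGroup P] [Module A P]
    [Module.Finite A P] [Module.Projective A P] :
    Function.Bijective (doubleDualEval (A := A) P) := by
  refine ⟨(injective_iff_map_eq_zero _).2 fun p hp => ?_, fun g => ?_⟩
  · by_contra hne
    obtain ⟨f, hf⟩ := exists_linearMap_apply_ne_zero (R := A) P hne
    exact hf (LinearMap.congr_fun hp f)
  · obtain ⟨p, hp⟩ := exists_eq_eval P g
    exact ⟨p, LinearMap.ext fun φ => (hp φ).symm⟩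

theorem linearMap_extOneRegular_eq_zero [IsNoetherianRing Aᵐᵒᵖ]
    (hR : ∀ I : Submodule Aᵐᵒᵖ Aᵐᵒᵖ, Module.Projective Aᵐᵒᵖ I) (N : ModuleCat.{u} Aᵐᵒᵖ)
    [Module.Finite Aᵐᵒᵖ N] :
    Module.Finite A (ExtOneRegular A N) ∧ ∀ f : ExtOneRegular A N →ₗ[A] A, f = 0 := by
  obtain ⟨n, π, hπ⟩ := Module.Finite.exists_fin' Aᵐᵒᵖ N
  have hS := shortExact_of_linearMap (LinearMap.ker π).subtype π (Submodule.subtype_injective _) hπ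
    (Submodule.range_subtype _)
  have hK : Module.Projective Aᵐᵒᵖ (LinearMap.ker π) :=
    projective_of_injective hR (LinearMap.ker π).subtype (Submodule.subtype_injective _)
  have hF := finite_dual_mulOpposite (A := A) (LinearMap.ker π)
  let δ : ((LinearMap.ker π) →ₗ[Aᵐᵒᵖ] A) →ₗ[A] ExtOneRegular A N := extConnecting hS
  have hδ : Function.Surjective δ := extConnecting_surjective hS
  refine ⟨Module.Finite.of_surjective δ hδ, fun f => ?_⟩
  obtain ⟨p, hp⟩ := exists_eq_eval_mulOpposite (LinearMap.ker π) (f ∘ₗ δ)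
  -- The coordinate forms on the free module restrict to forms on the kernel that die in `Ext¹`, so
  -- all coordinates of `p` vanish.
  have hp0 : p = 0 := by
    refine Subtype.ext (funext fun i => ?_)
    let ψ : (Fin n → Aᵐᵒᵖ) →ₗ[Aᵐᵒᵖ] A :=
      (mulOppositeRegularEquiv A).toLinearMap ∘ₗ LinearMap.proj i
    have h1 := hp (ψ ∘ₗ (LinearMap.ker π).subtype)
    have h2 : δ (ψ ∘ₗ (LinearMap.ker π).subtype) = 0 :=
      (extConnecting_eq_zero_iff hS _).2 ⟨ψ, rfl⟩
    rw [LinearMap.comp_apply, h2, map_zero] at h1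
    exact MulOpposite.unop_injective h1.symm
  refine LinearMap.ext fun x => ?_
  obtain ⟨φ, rfl⟩ := hδ x
  exact (hp φ).trans (by rw [hp0, map_zero, LinearMap.zero_apply])

theorem exists_equiv_extOneRegular [IsNoetherianRing A]
    (hR : ∀ I : Submodule A A, Module.Projective A I) (M : ModuleCat.{u} A)
    [Module.Finite A M] (hM : ∀ f : M →ₗ[A] A, f = 0) :
    ∃ N : ModuleCat.{u} Aᵐᵒᵖ, Module.Finite Aᵐᵒᵖ N ∧ Nonempty (M ≃ₗ[A] ExtOneRegular A N) := by
  obtain ⟨n, π, hπ⟩ := Module.Finite.exists_fin' A M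
  have hK : Module.Projective A (LinearMap.ker π) :=
    projective_of_injective hR (LinearMap.ker π).subtype (Submodule.subtype_injective _)
  obtain ⟨hKf, hKp⟩ := finite_projective_dual (A := A) (LinearMap.ker π)
  let res : ((Fin n → A) →ₗ[A] A) →ₗ[Aᵐᵒᵖ] (LinearMap.ker π →ₗ[A] A) :=
    { toFun := fun φ => φ ∘ₗ (LinearMap.ker π).subtype
      map_add' := fun _ _ => rfl
      map_smul' := fun _ _ => rfl }
  -- A form on the free module that vanishes on the kernel of `π` descends to `M`, where all forms
  -- are zero.
  have hres : Function.Injective res := by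
    refine (injective_iff_map_eq_zero _).2 fun φ hφ => LinearMap.ext fun x => ?_
    have hle : LinearMap.ker π ≤ LinearMap.ker φ := fun y hy =>
      LinearMap.congr_fun hφ ⟨y, hy⟩
    have h0 := hM ((LinearMap.ker π).liftQ φ hle ∘ₗ (π.quotKerEquivOfSurjective hπ).symm.toLinearMap)
    have := LinearMap.congr_fun h0 (π x)
    have h1 : (π.quotKerEquivOfSurjective hπ).symm (π x) = Submodule.Quotient.mk x :=
      (LinearEquiv.symm_apply_eq _).2 rfl
    rw [LinearMap.comp_apply, LinearEquiv.coe_coe, h1, Submodule.liftQ_apply] at this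
    exact this
  have hS := shortExact_of_linearMap res (LinearMap.range res).mkQ hres
    (Submodule.mkQ_surjective _) (Submodule.ker_mkQ _).symm
  refine ⟨ModuleCat.of Aᵐᵒᵖ ((LinearMap.ker π →ₗ[A] A) ⧸ LinearMap.range res),
    Module.Finite.quotient _ _, ?_⟩
  let δ : (((Fin n → A) →ₗ[A] A) →ₗ[Aᵐᵒᵖ] A) →ₗ[A] ExtOneRegular A
    (ModuleCat.of Aᵐᵒᵖ ((LinearMap.ker π →ₗ[A] A) ⧸ LinearMap.range res)) := extConnecting hS
  have hδ : Function.Surjective δ := extConnecting_surjective hS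
  let θ := δ ∘ₗ doubleDualEval (A := A) (Fin n → A)
  have hθ : Function.Surjective θ := hδ.comp (doubleDualEval_bijective _).2
  -- Under evaluation, restriction along `res` becomes the inclusion of the kernel of `π` into the
  -- free module, so the cokernel computing `Ext¹` is `M`.
  have hker : LinearMap.ker π = LinearMap.ker θ := by
    ext x
    refine Iff.trans ?_ (extConnecting_eq_zero_iff hS (doubleDualEval _ x)).symm
    constructor
    · intro hx
      exact ⟨doubleDualEval _ ⟨x, hx⟩, rfl⟩
    · rintro ⟨ψ, hψ⟩
      obtain ⟨y, rfl⟩ := (doubleDualEval_bijective _).2 ψ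
      have : doubleDualEval (A := A) _ x = doubleDualEval _ (y : Fin n → A) := hψ
      rw [(doubleDualEval_bijective _).1 this]
      exact y.2
  exact ⟨(π.quotKerEquivOfSurjective hπ).symm ≪≫ₗ Submodule.quotEquivOfEq _ _ hker ≪≫ₗ
    θ.quotKerEquivOfSurjective hθ⟩

theorem isFiniteLength_iff_finite [IsNoetherianRing A] [IsArtinianRing A] (M : Type u)
    [AddCommGroup M] [Module A M] : IsFiniteLength A M ↔ Module.Finite A M := by
  rw [isFiniteLength_iff_isNoetherian_isArtinian]
  exact ⟨fun h => have := h.1; inferInstance, fun h => ⟨inferInstance, inferInstance⟩⟩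

theorem classW_iff [IsNoetherianRing A] [IsArtinianRing A] [IsNoetherianRing Aᵐᵒᵖ]
    (hA : IsHereditaryRing A) (M : ModuleCat.{u} A) :
    classW A M ↔ IsFiniteLength A M ∧ ∀ f : M →ₗ[A] A, f = 0 := by
  rw [isFiniteLength_iff_finite]
  constructor
  · rintro ⟨N, hN, ⟨e⟩⟩
    obtain ⟨h1, h2⟩ := linearMap_extOneRegular_eq_zero
      (projective_mulOpposite hA.projective_right) N
    refine ⟨Module.Finite.equiv e.symm, fun f => LinearMap.ext fun x => ?_⟩
    have := LinearMap.congr_fun (h2 (f ∘ₗ e.symm.toLinearMap)) (e x)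
    simpa using this
  · rintro ⟨_, h⟩
    exact exists_equiv_extOneRegular hA.projective_left M h

theorem isClosedUnderSubobjects_classW_iff [IsNoetherianRing A] [IsArtinianRing A]
    [IsNoetherianRing Aᵐᵒᵖ] (hA : IsHereditaryRing A) :
    (classW A).IsClosedUnderSubobjects ↔
      ∀ (M N : Type u) [AddCommGroup M] [Module A M] [AddCommGroup N] [Module A N]
        (j : N →ₗ[A] M), Module.Finite A M → Function.Injective j → (∀ f : M →ₗ[A] A, f = 0) →
        ∀ f : N →ₗ[A] A, f = 0 := by
  constructor
  · intro h M N _ _ _ _ j hM hj hf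
    have : Mono (ModuleCat.ofHom j) := (ModuleCat.mono_iff_injective _).2 hj
    exact ((classW_iff hA _).1 (h.prop_of_mono (ModuleCat.ofHom j)
      ((classW_iff hA (ModuleCat.of A M)).2 ⟨(isFiniteLength_iff_finite M).2 hM, hf⟩))).2
  · refine fun h => ⟨fun {X Y} j _ hY => ?_⟩
    obtain ⟨hY1, hY2⟩ := (classW_iff hA Y).1 hY
    have hj := (ModuleCat.mono_iff_injective j).1 inferInstance
    exact (classW_iff hA X).2 ⟨hY1.of_injective (f := j.hom) hj,
      h Y X j.hom ((isFiniteLength_iff_finite Y).1 hY1) hj hY2⟩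

end DualBasis

theorem mainTheorem5 (A : Type u) [Ring A] (hartin : IsArtinAlgebra A)
    (hhered : IsHereditaryRing A) :
    Function.Bijective (toRightEndDual A) ∧
      classW A = classXDual A ∧
      classXDual A = classNoProjectiveSummand A ∧
      ((classW A).IsClosedUnderSubobjects ↔ IsNakayamaAlgebra A) := by
  have hR := hhered.projective_left
  have := hartin.finite_center
  have := isSemisimpleRing_center hartin hR
  have := hartin.isNoetherianRing
  have := hartin.isArtinianRing
  have := hartin.isNoetherianRing_mulOpposite
  have hE (M : Type u) [AddCommGroup M] [Module A M] (_ : Module.Finite A M) :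
      ∃ (E : Type u) (_ : AddCommGroup E) (_ : Module A E), Module.Finite A E ∧
        Module.Injective A E ∧ ∃ g : M →ₗ[A] E, Function.Injective g := by
    obtain ⟨n, g, hg⟩ := DualRegular.exists_injective_pi (A := A) M
    exact ⟨Fin n → DualRegular A, inferInstance, inferInstance, inferInstance,
      Module.Injective.pi A _, g, hg⟩
  refine ⟨DualRegular.bijective_toRightEndDual, funext fun M => propext ?_,
    funext fun M => propext ?_, ?_⟩
  · rw [classW_iff hhered, classXDual_iff]
  · rw [classXDual_iff, classNoProjectiveSummand_iff hR]
  · rw [isClosedUnderSubobjects_classW_iff hhered]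
    constructor
    · intro hC
      have hQ (P : Type u) [AddCommGroup P] [Module A P] (_ : Module.Finite A P)
          (_ : Module.Projective A P) := exists_projective_injective_of_closed hR hE hC P
      exact ⟨hartin, fun P _ _ _ _ hP => isUniserialModule_of_projective_of_closed hR hQ P hP,
        fun I _ _ _ _ hI => isUniserialModule_of_injective_of_closed hR hQ I hI⟩
    · intro hN M L _ _ _ _ j hM hj hf f
      by_contra hne
      obtain ⟨U, hU, i, p, hpi⟩ := exists_retract_of_linearMap_ne_zero hR f hne
      have := hR U
      obtain ⟨g, hg⟩ := exists_linearMap_ne_zero_of_uniserial hE hN.uniserial_of_projective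
        hN.uniserial_of_injective hU (j ∘ₗ i)
        (hj.comp (LinearMap.injective_of_comp_eq_id i p hpi))
      exact hg (hf g)
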